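/- **Conventions.** A graph $\Gamma$ is a directed multigraph with edges $e\colon\iota(e)\to\tau(e)$; paths are directed, and a path is simple if it visits no vertex twice. An $A$-automaton $\mathscr A=(\Gamma,\ell)$ is a graph with a labelling $\ell$ of its edges by letters of $A$ such that distinct edges leaving the same vertex have distinct labels. The acceptor $(\mathscr A,I,\{q\})$ is trim if every vertex lies on a path from $I$ to $q$; its language is the set of all words of $A^*$ (the empty word included) that label a path from $I$ to $q$. $(\Gamma,I)$ has the unique simple path property if for each vertex $w$ there is exactly one simple path from $I$ to $w$; then $(\Gamma,I)$ has a unique directed spanning tree $T$, the edges outside $T$ are called bold, and $[u,w]$ denotes the path in $T$ from $u$ to $w$, if there is one (written $w\le_T u$). A geometric rank function $r$ assigns natural numbers to the bold edges so that, for each vertex $w$, the $n_w$ bold edges ending at $w$ are mapped bijectively to $\{0,\dots,n_w-1\}$. A transition edge is an edge whose endpoints lie in different strong components; strong components are full subgraphs. A subgraph $\Delta$ is closed with respect to a vertex $u$ if $u\in\Delta$ and all vertices $w$ of $\Delta$ satisfy $w\le_T u$ and $[u,w]\subseteq\Delta$, and every bold edge $e$ with $u\ne\tau(e)\in\Delta$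 belongs to $\Delta$. For a subgraph $\Delta$ all of whose vertices are $\le_T u$, the closure $\overline{(\Delta,u)}$ is the intersection of all subgraphs containing $\Delta$ that are closed with respect to $u$. For a bold edge $e$ let $\mathrm{lp}(e)$ be the circuit $[\tau(e),\iota(e)]e$. The cut sloop $\mathrm{cut}(e)$ is obtained from $\overline{(\mathrm{lp}(e),\tau(e))}$ by making each edge $f$ that ends at $\tau(e)$ end instead at a new vertex of its own; the new end of $e$ is denoted $\tau(e)'$. **The expression.** Let $(\mathscr A,I,\{q\})$ be a finite trim acceptor with the unique simple path property at $I$ and let $r$ be a geometric rank function. Define $\mathcal K(\mathscr A,I,q,r)$ recursively (restrictions of $r$ are again denoted $r$): 1. If there are no bold edges, $\mathcal K(\mathscr A,I,q,r)=\ell([I,q])$. 2. If there are bold edges and the chain of strong components $C_0>C_1>\dots>C_n$ has $n\ge1$, let $e_n\colon q_{n-1}\to p_n$ be the transition edge entering $C_n$, and let $\mathscr A(q_{n-1})$ be the full subautomaton of all vertices from which $q_{n-1}$ can be reached. Then $$\mathcal K(\mathscr A,I,q,r)=\mathcal K(\mathscr A(q_{n-1}),I,q_{n-1},r)\,\ell(e_n)\,\mathcal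 K(C_n,p_n,q,r).$$ 3. If there are bold edges and only one strong component, let $e$ be the bold edge ending at $I$ of largest rank and let $\mathscr B$ be the strong component of $I$ in $\mathscr A$ with $e$ removed. Then $$\mathcal K(\mathscr A,I,q,r)=\mathcal K(\mathscr B,I,I,r)\,\bigl[\mathcal K(\mathrm{cut}(e),I,I',r)\,\mathcal K(\mathscr B,I,I,r)\bigr]^*\,\mathcal K\bigl(\overline{([I,q],I)},I,q,r\bigr).$$ **Theorem.** Let $(\mathscr A,I,\{q\})$ be a finite trim acceptor over $A$ with a single terminal state $q$ and the unique simple path property at $I$, and let $r$ be a geometric rank function. Then the recursion above is well defined, that is, it produces exactly one expression $\mathcal K(\mathscr A,I,q,r)$; this expression is built from letters and the empty word by concatenation and star only (no union), and its language is exactly the language of all words labelling a path from $I$ to $q$ in $\mathscr A$. -/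

import Mathlib

universe u v

namespace GeomAut

/-- An automaton over the alphabet `A`: a directed multigraph with vertex type `V`, edge type `E`
and incidence maps `src`, `tgt`, together with a labelling `lab` of the edges by letters, which is
(partial) deterministic: distinct edges leaving the same vertex have distinct labels. -/
structure Automaton (A : Type v) where
  V : Type u
  E : Type u
  src : E → V
  tgt : E → V
  lab : E → A
  det : ∀ e f : E, src e = src f → lab e = lab f → e = f

namespace Automaton

variable {A : Type v} (M : Automaton.{u, v} A)

/-! ### Paths, accessibility, strong components -/

/-- `M.IsPath x p y`: the list of edges `p` is a directed path from `x` to `y`. The empty list is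
the empty path at each vertex. -/
def IsPath : M.V → List M.E → M.V → Prop
  | x, [], y => x = y
  | x, e :: p, y => M.src e = x ∧ IsPath (M.tgt e) p y

/-- `M.IsPathIn S x p y`: `p` is a directed path from `x` to `y` all of whose edges lie in `S`. -/
def IsPathIn (S : Set M.E) (x : M.V) (p : List M.E) (y : M.V) : Prop :=
  M.IsPath x p y ∧ ∀ e ∈ p, e ∈ S

/-- `p` is a simple path from `x` to `y`: a path that visits no vertex twice. -/
def IsSimplePath (x : M.V) (p : List M.E) (y : M.V) : Prop :=
  M.IsPath x p y ∧ (x :: p.map M.tgt).Nodup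

/-- `y` can be reached from `x` by a directed path with all edges in `S`. -/
def ReachIn (S : Set M.E) (x y : M.V) : Prop := ∃ p, M.IsPathIn S x p y

/-- `y` can be reached from `x` by a directed path. -/
def Reach (x y : M.V) : Prop := ∃ p, M.IsPath x p y

/-- `x` and `y` lie in the same strong component of the graph with edge set `S`. -/
def SameCompIn (S : Set M.E) (x y : M.V) : Prop := M.ReachIn S x y ∧ M.ReachIn S y x

/-- `x` and `y` lie in the same strong component. -/
def SameComp (x y : M.V) : Prop := M.Reach x y ∧ M.Reach y x

/-- An edge is a transition edge if its endpoints lie in different strong components. -/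
def IsTransition (e : M.E) : Prop := ¬ M.SameComp (M.src e) (M.tgt e)

/-! ### Acceptors -/

/-- The acceptor with initial state `I` and single terminal state `q` is trim: every vertex lies on
a directed path from `I` to `q`. -/
def Trim (I q : M.V) : Prop := ∀ x, M.Reach I x ∧ M.Reach x q

/-- The language accepted with initial state `I` and single terminal state `q`: all words
(the empty word included) labelling a directed path from `I` to `q`. -/
def language (I q : M.V) : Language A := {w | ∃ p, M.IsPath I p q ∧ p.map M.lab = w}

/-! ### The unique simple path property, bold arrows, rank functions -/

/-- The unique simple path property of the graph rooted at `I`. -/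
def UniqueSimplePath (I : M.V) : Prop := ∀ x, ∃! p, M.IsSimplePath I p x

/-- `S` is the edge set of a directed spanning tree rooted at `I`: inside `S` there is exactly one
directed path from `I` to each vertex of the graph. -/
def IsSpanningTree (I : M.V) (S : Set M.E) : Prop := ∀ x, ∃! p, M.IsPathIn S I p x

/-- The edge set of the directed spanning tree at `I`; there is only one such tree when the graph
has the unique simple path property at `I`. -/
def treeEdges (I : M.V) : Set M.E := {e | ∃ S, M.IsSpanningTree I S ∧ e ∈ S}

/-- Bold arrows: the edges that are not in the spanning tree. -/
def Bold (I : M.V) (e : M.E) : Prop := e ∉ M.treeEdges I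

/-- `r` is a geometric rank function: for each vertex `x` it maps the bold arrows ending at `x`
bijectively to `{0, …, n - 1}`, where `n` is their number. Only the values of `r` on bold arrows
are relevant. -/
def IsGeometricRank (I : M.V) (r : M.E → ℕ) : Prop :=
  ∀ x, Set.BijOn r {e | M.Bold I e ∧ M.tgt e = x} (Set.Iio {e | M.Bold I e ∧ M.tgt e = x}.ncard)

/-! ### Subgraphs -/

/-- A subgraph: a set of vertices and a set of edges between them. -/
structure Sub where
  verts : Set M.V
  edges : Set M.E
  src_mem : ∀ e ∈ edges, M.src e ∈ verts
  tgt_mem : ∀ e ∈ edges, M.tgt e ∈ verts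

variable {M} in
/-- Inclusion of subgraphs. -/
def Sub.Le (D D' : M.Sub) : Prop := D.verts ⊆ D'.verts ∧ D.edges ⊆ D'.edges

variable {M} in
/-- A subgraph, as an automaton in its own right. -/
def Sub.toAutomaton (D : M.Sub) : Automaton.{u, v} A where
  V := {x // x ∈ D.verts}
  E := {e // e ∈ D.edges}
  src e := ⟨M.src e.1, D.src_mem e.1 e.2⟩
  tgt e := ⟨M.tgt e.1, D.tgt_mem e.1 e.2⟩
  lab e := M.lab e.1
  det e f hs hl := Subtype.ext (M.det e.1 f.1 (congrArg Subtype.val hs) hl)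

/-- The subgraph with vertex set `X` and all those edges of `S` that connect vertices in `X`. -/
def inducedIn (S : Set M.E) (X : Set M.V) : M.Sub where
  verts := X
  edges := {e | e ∈ S ∧ M.src e ∈ X ∧ M.tgt e ∈ X}
  src_mem _ h := h.2.1
  tgt_mem _ h := h.2.2

/-- The full subgraph of all vertices from which `y` can be reached. -/
def above (y : M.V) : M.Sub := M.inducedIn Set.univ {x | M.Reach x y}

/-- The strong component of the vertex `y`. -/
def strongComp (y : M.V) : M.Sub := M.inducedIn Set.univ {x | M.SameComp x y}

/-- The strong component of the vertex `y` after removal of the edge `e`. -/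
def removeComp (e : M.E) (y : M.V) : M.Sub := M.inducedIn {e}ᶜ {x | M.SameCompIn {e}ᶜ x y}

/-- The subgraph `[x, y]`: the geodesic in the spanning tree from `x` to a vertex `y` below `x` in
the tree (the path in the tree from `x` to `y` is unique). -/
def geodesic (I x y : M.V) : M.Sub where
  verts := {z | z = x ∨ z = y ∨
    ∃ p, M.IsPathIn (M.treeEdges I) x p y ∧ ∃ e ∈ p, z = M.src e ∨ z = M.tgt e}
  edges := {e | ∃ p, M.IsPathIn (M.treeEdges I) x p y ∧ e ∈ p}
  src_mem e := fun ⟨p, hp, he⟩ => Or.inr (Or.inr ⟨p, hp, e, he, Or.inl rfl⟩)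
  tgt_mem e := fun ⟨p, hp, he⟩ => Or.inr (Or.inr ⟨p, hp, e, he, Or.inr rfl⟩)

/-- The loop of the bold arrow `e`: the simple circuit `[tgt e, src e] e`, as a subgraph. -/
def loop (I : M.V) (e : M.E) : M.Sub where
  verts := (M.geodesic I (M.tgt e) (M.src e)).verts
  edges := insert e (M.geodesic I (M.tgt e) (M.src e)).edges
  src_mem f hf := by
    rcases hf with rfl | hf
    · exact Or.inr (Or.inl rfl)
    · exact (M.geodesic I (M.tgt e) (M.src e)).src_mem f hf
  tgt_mem f hf := by
    rcases hf with rfl | hf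
    · exact Or.inl rfl
    · exact (M.geodesic I (M.tgt e) (M.src e)).tgt_mem f hf

/-! ### Closed subgraphs and closures -/

/-- The subgraph `D` is closed with respect to the vertex `x`: it contains `x`, its vertices lie
below `x` in the spanning tree, it contains the geodesic from `x` to each of its vertices, and it
contains each bold arrow that ends at a vertex of `D` other than `x`. -/
def Closed (I x : M.V) (D : M.Sub) : Prop :=
  (x ∈ D.verts ∧ ∀ y ∈ D.verts, M.ReachIn (M.treeEdges I) x y) ∧
  (∀ y ∈ D.verts, (M.geodesic I x y).Le D) ∧
  (∀ e, M.Bold I e → M.tgt e ≠ x → M.tgt e ∈ D.verts → e ∈ D.edges)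

/-- The closure of `D` with respect to `x`: the intersection of all subgraphs closed with respect
to `x` that contain `D`. -/
def closure (I x : M.V) (D : M.Sub) : M.Sub where
  verts := {y | ∀ D' : M.Sub, M.Closed I x D' → D.Le D' → y ∈ D'.verts}
  edges := {e | ∀ D' : M.Sub, M.Closed I x D' → D.Le D' → e ∈ D'.edges}
  src_mem e he D' h h' := D'.src_mem e (he D' h h')
  tgt_mem e he D' h h' := D'.tgt_mem e (he D' h h')

theorem self_mem_closure (I x : M.V) (D : M.Sub) : x ∈ (M.closure I x D).verts :=
  fun _ h _ => h.1.1

theorem vert_mem_closure (I x : M.V) (D : M.Sub) {y : M.V} (hy : y ∈ D.verts) :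
    y ∈ (M.closure I x D).verts :=
  fun _ _ h => h.1 hy

theorem edge_mem_closure (I x : M.V) (D : M.Sub) {e : M.E} (he : e ∈ D.edges) :
    e ∈ (M.closure I x D).edges :=
  fun _ _ h => h.2 he

/-! ### Cutting -/

open Classical in
/-- Cutting at the vertex `x`: each edge `e` ending at `x` is made to end at a new vertex of its
own, `Sum.inr e`. The other endpoints and all labels are kept. -/
noncomputable def cut (x : M.V) : Automaton.{u, v} A where
  V := M.V ⊕ {e : M.E // M.tgt e = x}
  E := M.E
  src e := Sum.inl (M.src e)
  tgt e := if h : M.tgt e = x then Sum.inr ⟨e, h⟩ else Sum.inl (M.tgt e)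
  lab := M.lab
  det e f hs hl := M.det e f (Sum.inl.inj hs) hl

/-- The closure, with respect to `tgt e`, of the loop of the bold arrow `e`. -/
def loopClosure (I : M.V) (e : M.E) : M.Sub := M.closure I (M.tgt e) (M.loop I e)

/-- The vertex `tgt e` of the closure of the loop of `e`. -/
def loopClosureBase (I : M.V) (e : M.E) : (M.loopClosure I e).toAutomaton.V :=
  ⟨M.tgt e, M.self_mem_closure I (M.tgt e) (M.loop I e)⟩

/-- The cut sloop of the bold arrow `e`: the closure of the loop of `e`, cut at `tgt e`. -/
noncomputable def cutSloop (I : M.V) (e : M.E) : Automaton.{u, v} A :=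
  (M.loopClosure I e).toAutomaton.cut (M.loopClosureBase I e)

/-- The vertex `tgt e` of the cut sloop of `e`. -/
noncomputable def cutSloopInit (I : M.V) (e : M.E) : (M.cutSloop I e).V :=
  Sum.inl (M.loopClosureBase I e)

/-- The new vertex of the cut sloop of `e` at which `e` ends. -/
noncomputable def cutSloopTerm (I : M.V) (e : M.E) : (M.cutSloop I e).V :=
  Sum.inr ⟨⟨e, M.edge_mem_closure I (M.tgt e) (M.loop I e) (Set.mem_insert e _)⟩, rfl⟩

/-- The restriction of `r` to the cut sloop of `e`, whose edges are edges of `M`. -/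
def cutSloopRank (I : M.V) (e : M.E) (r : M.E → ℕ) : (M.cutSloop I e).E → ℕ :=
  fun f : {f // f ∈ (M.loopClosure I e).edges} => r f.1

/-- The closure of the geodesic `[I, q]` with respect to `I`. -/
def geodesicClosure (I q : M.V) : M.Sub := M.closure I I (M.geodesic I I q)

variable {M} in
/-- The restriction of `r` to a subgraph. -/
def Sub.rank (D : M.Sub) (r : M.E → ℕ) : D.toAutomaton.E → ℕ :=
  fun f : {f // f ∈ D.edges} => r f.1

variable {M} in
theorem mem_above {x y : M.V} (h : M.Reach x y) : x ∈ (M.above y).verts := h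

theorem self_mem_above (y : M.V) : y ∈ (M.above y).verts := ⟨[], rfl⟩

variable {M} in
theorem mem_strongComp {x y : M.V} (h : M.SameComp x y) : x ∈ (M.strongComp y).verts := h

theorem self_mem_strongComp (y : M.V) : y ∈ (M.strongComp y).verts := ⟨⟨[], rfl⟩, ⟨[], rfl⟩⟩

theorem self_mem_removeComp (e : M.E) (y : M.V) : y ∈ (M.removeComp e y).verts :=
  ⟨⟨[], rfl, fun _ h => absurd h List.not_mem_nil⟩, ⟨[], rfl, fun _ h => absurd h List.not_mem_nil⟩⟩

theorem terminal_mem_geodesicClosure (I q : M.V) : q ∈ (M.geodesicClosure I q).verts :=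
  M.vert_mem_closure I I _ (Or.inr (Or.inl rfl))

end Automaton

open RegularExpression Automaton

/-! ### The Kleene expression -/

/-- A regular expression is unionless if it is built from letters and the empty word by
concatenation and star only. -/
inductive Unionless {A : Type v} : RegularExpression A → Prop
  | epsilon : Unionless 1
  | char (a : A) : Unionless (char a)
  | comp {P Q : RegularExpression A} : Unionless P → Unionless Q → Unionless (P * Q)
  | star {P : RegularExpression A} : Unionless P → Unionless (star P)

/-- `IsKleene M I q r K`: the recursion that defines the Kleene expression of the automaton `M`
with initial state `I`, terminal state `q` and rank function `r` produces the expression `K`. -/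
inductive IsKleene {A : Type v} :
    (M : Automaton.{u, v} A) → M.V → M.V → (M.E → ℕ) → RegularExpression A → Prop
  /-- Without bold arrows, `K` is the word labelling the geodesic from `I` to `q`. -/
  | base {M : Automaton.{u, v} A} {I q : M.V} {r : M.E → ℕ} (p : List M.E)
      (nobold : ∀ e, ¬ M.Bold I e) (hp : M.IsSimplePath I p q) :
      IsKleene M I q r (p.map fun e => char (M.lab e)).prod
  /-- If there are bold arrows and more than one strong component, let `e` be the last transition
  edge, that is, the one that enters the last strong component, which is the one of `q`. Then `K` is
  the concatenation of the expression for the part of `M` above `src e`, the label of `e`, and the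
  expression for the last strong component. -/
  | elementary {M : Automaton.{u, v} A} {I q : M.V} {r : M.E → ℕ} (e : M.E)
      {K₁ K₂ : RegularExpression A}
      (bold : ∃ f, M.Bold I f) (he : M.IsTransition e)
      (hI : M.Reach I (M.src e)) (hq : M.SameComp q (M.tgt e))
      (h₁ : IsKleene (M.above (M.src e)).toAutomaton ⟨I, mem_above hI⟩
        ⟨M.src e, M.self_mem_above (M.src e)⟩ ((M.above (M.src e)).rank r) K₁)
      (h₂ : IsKleene (M.strongComp (M.tgt e)).toAutomaton
        ⟨M.tgt e, M.self_mem_strongComp (M.tgt e)⟩ ⟨q, mem_strongComp hq⟩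
        ((M.strongComp (M.tgt e)).rank r) K₂) :
      IsKleene M I q r (K₁ * char (M.lab e) * K₂)
  /-- If there are bold arrows and only one strong component, let `e` be the bold arrow of largest
  rank among those ending at `I`. With `K₁` the expression from `I` to `I` for the strong component
  of `I` after removal of `e`, `K₂` the expression of the cut sloop of `e`, and `K₃` the expression
  from `I` to `q` of the closure of the geodesic `[I, q]`, `K` is `K₁ (K₂ K₁)* K₃`. -/
  | loop {M : Automaton.{u, v} A} {I q : M.V} {r : M.E → ℕ} (e : M.E)
      {K₁ K₂ K₃ : RegularExpression A}
      (conn : ∀ x y, M.Reach x y) (bold : M.Bold I e) (he : M.tgt e = I)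
      (hmax : ∀ f, M.Bold I f → M.tgt f = I → r f ≤ r e)
      (h₁ : IsKleene (M.removeComp e I).toAutomaton
        ⟨I, M.self_mem_removeComp e I⟩ ⟨I, M.self_mem_removeComp e I⟩
        ((M.removeComp e I).rank r) K₁)
      (h₂ : IsKleene (M.cutSloop I e) (M.cutSloopInit I e) (M.cutSloopTerm I e)
        (M.cutSloopRank I e r) K₂)
      (h₃ : IsKleene (M.geodesicClosure I q).toAutomaton
        ⟨I, M.self_mem_closure I I (M.geodesic I I q)⟩ ⟨q, M.terminal_mem_geodesicClosure I q⟩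
        ((M.geodesicClosure I q).rank r) K₃) :
      IsKleene M I q r (K₁ * star (K₂ * K₁) * K₃)

end GeomAut

/-! The unique simple path property yields a tree with back edges. The edges on simple paths from
`I` form a spanning tree `T`, and every other edge leads from a vertex to one of its ancestors in
`T` (`UniqueSimplePath.exists_backTree`). This form, `BackTree`, passes to all the pieces of the
recursion, and it identifies the bold edges as those outside `T`.

Two identities give the language. Transition edges lie in `T`, and each strong component is entered
by at most one of them (`BackTree.eq_of_isTransition`), so a path ending in a component it did not
start in factors at that edge (`BackTree.elementary_decomposition`). In a strongly connected
automaton a path is cut at its visits to `I`: the returns through `e` separate the blocks of the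
star, the other returns belong to circuits avoiding `e`, and the final stretch never comes back to
`I` (`loop_decomposition`). The closures match these pieces because they consist of the paths that
do not return to the root (`BackTree.closure_eq`).

Uniqueness of the expression holds because the three cases exclude each other and the chosen edge is
forced, by the single entrance or by injectivity of the rank at the root. Removing the edge of
largest rank leaves an initial segment of ranks, so the rank condition is inherited. The recursion
terminates because the number of edges plus the number of edges outside `T` drops: a subgraph loses
an edge, and cutting turns `e` into a tree edge. -/

namespace GeomAut

open RegularExpression Automaton
open scoped Computability

namespace Automaton

variable {A : Type v} {M : Automaton.{u, v} A}

/-! ### Paths -/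

theorem isPath_append {x z : M.V} {p q : List M.E} :
    M.IsPath x (p ++ q) z ↔ ∃ y, M.IsPath x p y ∧ M.IsPath y q z := by
  induction p generalizing x with
  | nil => simp [IsPath]
  | cons e p ih => simp [IsPath, ih, and_assoc]

theorem isPath_concat {x z : M.V} {p : List M.E} {e : M.E} :
    M.IsPath x (p ++ [e]) z ↔ M.IsPath x p (M.src e) ∧ M.tgt e = z := by
  rw [isPath_append]
  constructor
  · rintro ⟨y, h, rfl, h'⟩
    exact ⟨h, h'⟩
  · rintro ⟨h, h'⟩
    exact ⟨_, h, rfl, h'⟩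

theorem isPathIn_nil (S : Set M.E) (x : M.V) : M.IsPathIn S x [] x :=
  ⟨rfl, fun _ h => absurd h List.not_mem_nil⟩

theorem isPathIn_cons {S : Set M.E} {x z : M.V} {p : List M.E} {e : M.E} :
    M.IsPathIn S x (e :: p) z ↔ M.src e = x ∧ e ∈ S ∧ M.IsPathIn S (M.tgt e) p z := by
  simp only [IsPathIn, IsPath, List.mem_cons, forall_eq_or_imp]
  tauto

theorem isPathIn_append {S : Set M.E} {x z : M.V} {p q : List M.E} :
    M.IsPathIn S x (p ++ q) z ↔ ∃ y, M.IsPathIn S x p y ∧ M.IsPathIn S y q z := by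
  simp only [IsPathIn, isPath_append, List.mem_append]
  constructor
  · rintro ⟨⟨y, h, h'⟩, k⟩
    exact ⟨y, ⟨h, fun e he => k e (Or.inl he)⟩, h', fun e he => k e (Or.inr he)⟩
  · rintro ⟨y, ⟨h, k⟩, h', k'⟩
    exact ⟨⟨y, h, h'⟩, fun e he => he.elim (k e) (k' e)⟩

theorem isPathIn_concat {S : Set M.E} {x z : M.V} {p : List M.E} {e : M.E} :
    M.IsPathIn S x (p ++ [e]) z ↔ M.IsPathIn S x p (M.src e) ∧ e ∈ S ∧ M.tgt e = z := by
  simp only [IsPathIn, isPath_concat, List.mem_append, List.mem_singleton, or_imp, forall_and,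
    forall_eq]
  tauto

theorem isPathIn_univ {x y : M.V} {p : List M.E} :
    M.IsPathIn Set.univ x p y ↔ M.IsPath x p y := by simp [IsPathIn]

theorem IsPathIn.mono {S S' : Set M.E} (h : S ⊆ S') {x y : M.V} {p : List M.E}
    (hp : M.IsPathIn S x p y) : M.IsPathIn S' x p y :=
  ⟨hp.1, fun e he => h (hp.2 e he)⟩

theorem reachIn_univ {x y : M.V} : M.ReachIn Set.univ x y ↔ M.Reach x y := by
  simp [ReachIn, Reach, isPathIn_univ]

theorem ReachIn.refl (S : Set M.E) (x : M.V) : M.ReachIn S x x := ⟨[], isPathIn_nil S x⟩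

theorem ReachIn.trans {S : Set M.E} {x y z : M.V} (h : M.ReachIn S x y) (h' : M.ReachIn S y z) :
    M.ReachIn S x z := by
  obtain ⟨p, hp⟩ := h
  obtain ⟨q, hq⟩ := h'
  exact ⟨p ++ q, isPathIn_append.2 ⟨y, hp, hq⟩⟩

theorem ReachIn.mono {S S' : Set M.E} (h : S ⊆ S') {x y : M.V} (hp : M.ReachIn S x y) :
    M.ReachIn S' x y :=
  hp.imp fun _ k => k.mono h

theorem ReachIn.edge {S : Set M.E} {e : M.E} (he : e ∈ S) : M.ReachIn S (M.src e) (M.tgt e) :=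
  ⟨[e], isPathIn_cons.2 ⟨rfl, he, isPathIn_nil _ _⟩⟩

theorem ReachIn.reach {S : Set M.E} {x y : M.V} (h : M.ReachIn S x y) : M.Reach x y :=
  reachIn_univ.1 (h.mono (Set.subset_univ S))

theorem Reach.refl (x : M.V) : M.Reach x x := ⟨[], rfl⟩

theorem Reach.trans {x y z : M.V} (h : M.Reach x y) (h' : M.Reach y z) : M.Reach x z :=
  reachIn_univ.1 ((reachIn_univ.2 h).trans (reachIn_univ.2 h'))

theorem Reach.edge (e : M.E) : M.Reach (M.src e) (M.tgt e) := ⟨[e], rfl, rfl⟩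

theorem SameComp.symm {x y : M.V} (h : M.SameComp x y) : M.SameComp y x := ⟨h.2, h.1⟩

theorem SameComp.trans {x y z : M.V} (h : M.SameComp x y) (h' : M.SameComp y z) :
    M.SameComp x z := ⟨h.1.trans h'.1, h'.2.trans h.2⟩

theorem ReachIn.eq_or_last {S : Set M.E} {x y : M.V} (h : M.ReachIn S x y) :
    x = y ∨ ∃ e ∈ S, M.tgt e = y ∧ M.ReachIn S x (M.src e) := by
  obtain ⟨p, hp⟩ := h
  rcases List.eq_nil_or_concat p with rfl | ⟨p, e, rfl⟩
  · exact Or.inl hp.1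
  · rw [List.concat_eq_append, isPathIn_concat] at hp
    exact Or.inr ⟨e, hp.2.1, hp.2.2, p, hp.1⟩

theorem IsPathIn.split_mem {S : Set M.E} {x y : M.V} {p : List M.E} (hp : M.IsPathIn S x p y)
    {e : M.E} (he : e ∈ p) : e ∈ S ∧ M.ReachIn S x (M.src e) ∧ M.ReachIn S (M.tgt e) y := by
  refine ⟨hp.2 e he, ?_⟩
  obtain ⟨p₁, p₂, rfl⟩ := List.append_of_mem he
  obtain ⟨z, h₁, h₂⟩ := isPathIn_append.1 hp
  obtain ⟨rfl, -, h₃⟩ := isPathIn_cons.1 h₂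
  exact ⟨⟨p₁, h₁⟩, p₂, h₃⟩

theorem IsPath.exists_split {x y z : M.V} {p : List M.E} (hp : M.IsPath x p y)
    (hz : z ∈ x :: p.map M.tgt) : ∃ p₁ p₂, p = p₁ ++ p₂ ∧ M.IsPath x p₁ z ∧ M.IsPath z p₂ y := by
  induction p generalizing x with
  | nil =>
    obtain rfl : z = x := by simpa using hz
    exact ⟨[], [], rfl, rfl, hp⟩
  | cons e p ih =>
    rw [List.mem_cons] at hz
    rcases hz with rfl | hz
    · exact ⟨[], e :: p, rfl, rfl, hp⟩
    · obtain ⟨p₁, p₂, rfl, h₁, h₂⟩ := ih hp.2 hz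
      exact ⟨e :: p₁, p₂, rfl, ⟨hp.1, h₁⟩, h₂⟩

theorem IsPath.end_mem {x y : M.V} {p : List M.E} (hp : M.IsPath x p y) :
    y ∈ x :: p.map M.tgt := by
  induction p generalizing x with
  | nil => exact List.mem_singleton.2 hp.symm
  | cons e p ih => exact List.mem_cons_of_mem _ (ih hp.2)

/-- If the new first vertex already occurs on the simple path built so far, everything before that
occurrence is dropped. Since only edges of the given path are used, the result stays in any edge set
containing it. -/
theorem IsPath.exists_isSimplePath {x y : M.V} {p : List M.E} (hp : M.IsPath x p y) :
    ∃ p', M.IsSimplePath x p' y ∧ ∀ e ∈ p', e ∈ p := by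
  induction p generalizing x with
  | nil => exact ⟨[], ⟨hp, by simp⟩, fun e he => he⟩
  | cons e p ih =>
    obtain ⟨p', ⟨h₁, h₂⟩, h₃⟩ := ih hp.2
    by_cases hx : x ∈ M.tgt e :: p'.map M.tgt
    · obtain ⟨q₁, q₂, rfl, h₄, h₅⟩ := h₁.exists_split hx
      refine ⟨q₂, ⟨h₅, ?_⟩, fun f hf => List.mem_cons_of_mem _ (h₃ f (List.mem_append_right _ hf))⟩
      rw [List.nodup_cons]
      refine ⟨fun hmem => ?_, ?_⟩
      · rw [List.map_append, ← List.cons_append, List.nodup_append] at h₂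
        exact h₂.2.2 x h₄.end_mem x hmem rfl
      · rw [List.map_append, ← List.cons_append, List.nodup_append] at h₂
        exact h₂.2.1
    · refine ⟨e :: p', ⟨⟨hp.1, h₁⟩, List.nodup_cons.2 ⟨hx, h₂⟩⟩, fun f hf => ?_⟩
      rcases List.mem_cons.1 hf with rfl | hf
      · exact List.mem_cons_self
      · exact List.mem_cons_of_mem _ (h₃ f hf)

theorem IsSimplePath.of_append {x y : M.V} {p q : List M.E} (h : M.IsSimplePath x (p ++ q) y) :
    ∃ z, M.IsSimplePath x p z ∧ M.IsPath z q y := by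
  obtain ⟨z, h₁, h₂⟩ := isPath_append.1 h.1
  refine ⟨z, ⟨h₁, ?_⟩, h₂⟩
  have := h.2
  rw [List.map_append, ← List.cons_append, List.nodup_append] at this
  exact this.1

theorem IsSimplePath.end_notMem {x y : M.V} {p : List M.E} {e : M.E}
    (h : M.IsSimplePath x (p ++ [e]) y) : M.tgt e ∉ x :: p.map M.tgt := by
  intro hmem
  have := h.2
  rw [List.map_append, ← List.cons_append, List.nodup_append] at this
  exact this.2.2 _ hmem (M.tgt e) (by simp) rfl

/-! ### Spanning trees all of whose non-tree edges lead back to an ancestor -/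

/-- `T` is a directed spanning tree rooted at `I`, and each edge outside `T` leads from a vertex to
one of its ancestors in `T`. -/
structure BackTree (M : Automaton.{u, v} A) (I : M.V) (T : Set M.E) : Prop where
  span : ∀ x, M.ReachIn T I x
  inj : ∀ e ∈ T, ∀ f ∈ T, M.tgt e = M.tgt f → e = f
  root : ∀ e ∈ T, M.tgt e ≠ I
  back : ∀ e ∉ T, M.ReachIn T (M.tgt e) (M.src e)

theorem UniqueSimplePath.exists_backTree {I : M.V} (h : M.UniqueSimplePath I) :
    ∃ T, M.BackTree I T := by
  -- A prefix of a simple path is simple, so such an edge is also the last edge of a simple path.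
  have key : ∀ e, (∃ x p, M.IsSimplePath I p x ∧ e ∈ p) →
      ∃ p, M.IsSimplePath I (p ++ [e]) (M.tgt e) := by
    rintro e ⟨x, p, hp, he⟩
    obtain ⟨p₁, p₂, rfl⟩ := List.append_of_mem he
    rw [← List.singleton_append, ← List.append_assoc] at hp
    obtain ⟨z, h₁, -⟩ := hp.of_append
    obtain rfl := (isPath_concat.1 h₁.1).2
    exact ⟨p₁, h₁⟩
  refine ⟨{e | ∃ x p, M.IsSimplePath I p x ∧ e ∈ p}, ?_, ?_, ?_, ?_⟩
  · intro x
    obtain ⟨p, hp, -⟩ := h x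
    exact ⟨p, hp.1, fun e he => ⟨x, p, hp, he⟩⟩
  · intro e he f hf hef
    obtain ⟨p, hp⟩ := key e he
    obtain ⟨q, hq⟩ := key f hf
    rw [← hef] at hq
    have := (h _).unique hp hq
    simpa using (List.append_inj' this rfl).2
  · intro e he hI
    obtain ⟨p, hp⟩ := key e he
    exact hp.end_notMem (hI ▸ List.mem_cons_self)
  · intro e he
    obtain ⟨p, hp, -⟩ := h (M.src e)
    -- Otherwise `p ++ [e]` would be simple and `e` would belong to the tree.
    have hmem : M.tgt e ∈ I :: p.map M.tgt := by
      by_contra hmem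
      refine he ⟨M.tgt e, p ++ [e], ⟨isPath_concat.2 ⟨hp.1, rfl⟩, ?_⟩, by simp⟩
      rw [List.map_append, ← List.cons_append]
      refine List.nodup_append.2 ⟨hp.2, by simp, ?_⟩
      rintro a ha b hb rfl
      obtain rfl : a = M.tgt e := by simpa using hb
      exact hmem ha
    obtain ⟨p₁, p₂, rfl, h₁, h₂⟩ := hp.1.exists_split hmem
    exact ⟨p₂, h₂, fun f hf => ⟨_, _, hp, List.mem_append_right _ hf⟩⟩

namespace BackTree

variable {I : M.V} {T : Set M.E}

/-- Tree paths can be read backwards: each vertex has at most one incoming tree edge and the root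
has none. -/
theorem eq_of_isPathIn_root (h : M.BackTree I T) {x : M.V} {p q : List M.E}
    (hp : M.IsPathIn T I p x) (hq : M.IsPathIn T I q x) : p = q := by
  induction p using List.reverseRecOn generalizing x q with
  | nil =>
    obtain rfl : I = x := hp.1
    rcases List.eq_nil_or_concat q with rfl | ⟨q, e, rfl⟩
    · rfl
    · rw [List.concat_eq_append, isPathIn_concat] at hq
      exact absurd hq.2.2 (h.root e hq.2.1)
  | append_singleton p e ih =>
    rw [isPathIn_concat] at hp
    rcases List.eq_nil_or_concat q with rfl | ⟨q, f, rfl⟩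
    · obtain rfl : I = x := hq.1
      exact absurd hp.2.2 (h.root e hp.2.1)
    · rw [List.concat_eq_append, isPathIn_concat] at hq
      obtain rfl := h.inj e hp.2.1 f hq.2.1 (hp.2.2.trans hq.2.2.symm)
      rw [List.concat_eq_append, ih hp.1 hq.1]

theorem eq_of_isPathIn (h : M.BackTree I T) {x y : M.V} {p q : List M.E}
    (hp : M.IsPathIn T x p y) (hq : M.IsPathIn T x q y) : p = q := by
  obtain ⟨s, hs⟩ := h.span x
  exact List.append_cancel_left (h.eq_of_isPathIn_root (isPathIn_append.2 ⟨x, hs, hp⟩)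
    (isPathIn_append.2 ⟨x, hs, hq⟩))

theorem isSpanningTree (h : M.BackTree I T) : M.IsSpanningTree I T := fun x => by
  obtain ⟨p, hp⟩ := h.span x
  exact ⟨p, hp, fun q hq => h.eq_of_isPathIn_root hq hp⟩

/-- The first edge outside `T` would lead back to an ancestor, which the path, so far a tree path,
has already visited. -/
theorem mem_of_isSimplePath (h : M.BackTree I T) {x : M.V} {p : List M.E}
    (hp : M.IsSimplePath I p x) : ∀ e ∈ p, e ∈ T := by
  induction p using List.reverseRecOn generalizing x with
  | nil => exact fun e he => absurd he List.not_mem_nil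
  | append_singleton p e ih =>
    obtain ⟨y, h₁, h₂, -⟩ := hp.of_append
    obtain rfl : M.src e = y := h₂
    have hpT := ih h₁
    have heT : e ∈ T := by
      by_contra heT
      obtain ⟨s, hs⟩ := h.back e heT
      obtain ⟨t, ht⟩ := h.span (M.tgt e)
      have := h.eq_of_isPathIn_root ⟨h₁.1, hpT⟩ (isPathIn_append.2 ⟨_, ht, hs⟩)
      apply hp.end_notMem
      rw [this, List.map_append, ← List.cons_append]
      exact List.mem_append_left _ ht.1.end_mem
    intro f hf
    rcases List.mem_append.1 hf with hf | hf
    · exact hpT f hf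
    · rwa [List.mem_singleton.1 hf]

/-- In any spanning tree `S`, removing repetitions from the `S`-path ending with `e` stays inside
`S`, so by uniqueness that path was already simple and therefore runs in `T`. -/
theorem treeEdges_eq (h : M.BackTree I T) : M.treeEdges I = T := by
  refine Set.Subset.antisymm ?_ fun e he => ⟨T, h.isSpanningTree, he⟩
  rintro e ⟨S, hS, he⟩
  obtain ⟨p, hp, -⟩ := hS (M.src e)
  have hpe : M.IsPathIn S I (p ++ [e]) (M.tgt e) := isPathIn_concat.2 ⟨hp, he, rfl⟩
  obtain ⟨p', h₁, h₂⟩ := hpe.1.exists_isSimplePath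
  have := (hS _).unique hpe ⟨h₁.1, fun f hf => hpe.2 f (h₂ f hf)⟩
  exact h.mem_of_isSimplePath h₁ e (by simp [← this])

theorem bold_iff (h : M.BackTree I T) {e : M.E} : M.Bold I e ↔ e ∉ T := by
  rw [Bold, h.treeEdges_eq]

theorem existsUnique_isSimplePath (h : M.BackTree I T) (x : M.V) :
    ∃! p, M.IsSimplePath I p x := by
  obtain ⟨p, hp⟩ := h.span x
  obtain ⟨p', h₁, -⟩ := hp.1.exists_isSimplePath
  exact ⟨p', h₁, fun q hq => h.eq_of_isPathIn_root ⟨hq.1, h.mem_of_isSimplePath hq⟩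
    ⟨h₁.1, h.mem_of_isSimplePath h₁⟩⟩

/-! ### Ancestors and transition edges -/

theorem reachIn_ne_root (h : M.BackTree I T) {x y : M.V} (hxy : M.ReachIn T x y) :
    M.ReachIn {f | M.tgt f ≠ I} x y :=
  hxy.mono fun f hf => h.root f hf

theorem not_reachIn_src (h : M.BackTree I T) {e : M.E} (he : e ∈ T) :
    ¬ M.ReachIn T (M.tgt e) (M.src e) := by
  rintro ⟨p, hp⟩
  have := h.eq_of_isPathIn (isPathIn_concat.2 ⟨hp, he, rfl⟩) (isPathIn_nil T (M.tgt e))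
  simp at this

/-- Going backwards from `z` there is no choice of tree edge, so the ancestors of `z` form a chain.
-/
theorem reachIn_total (h : M.BackTree I T) {x y z : M.V} (hx : M.ReachIn T x z)
    (hy : M.ReachIn T y z) : M.ReachIn T x y ∨ M.ReachIn T y x := by
  obtain ⟨p, hp⟩ := hx
  induction p using List.reverseRecOn generalizing z with
  | nil =>
    obtain rfl : x = z := hp.1
    exact Or.inr hy
  | append_singleton p e ih =>
    obtain ⟨h₁, h₂, rfl⟩ := isPathIn_concat.1 hp
    rcases hy.eq_or_last with rfl | ⟨f, hf, hfe, hy'⟩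
    · exact Or.inl ⟨_, hp⟩
    · obtain rfl := h.inj f hf e h₂ hfe
      exact ih hy' h₁

theorem mem_of_isTransition (h : M.BackTree I T) {e : M.E} (he : M.IsTransition e) : e ∈ T := by
  by_contra hT
  exact he ⟨Reach.edge e, (h.back e hT).reach⟩

/-- A back edge met after a transition edge `e` cannot jump above `tgt e`: its target would reach
`src e` along the tree, putting both ends of `e` on a circuit. -/
theorem reachIn_of_isTransition (h : M.BackTree I T) {e : M.E} (he : M.IsTransition e) {y : M.V}
    (hy : M.Reach (M.tgt e) y) : M.ReachIn T (M.tgt e) y := by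
  obtain ⟨p, hp⟩ := hy
  induction p using List.reverseRecOn generalizing y with
  | nil =>
    obtain rfl : M.tgt e = y := hp
    exact ReachIn.refl _ _
  | append_singleton p f ih =>
    obtain ⟨h₁, rfl⟩ := isPath_concat.1 hp
    have := ih h₁
    by_cases hf : f ∈ T
    · exact this.trans (ReachIn.edge hf)
    rcases h.reachIn_total this (h.back f hf) with h₂ | h₂
    · exact h₂
    rcases h₂.eq_or_last with h₃ | ⟨g, hg, hge, h₃⟩
    · rw [h₃]; exact ReachIn.refl _ _
    · obtain rfl := h.inj g hg e (h.mem_of_isTransition he) hge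
      exact absurd ⟨Reach.edge g, Reach.trans ⟨_, hp⟩ h₃.reach⟩ he

/-- The tree path from `tgt e` to `tgt f` is either empty, and then both are the unique tree edge
into that vertex, or it ends with `f`, which then lies on a circuit. -/
theorem eq_of_isTransition (h : M.BackTree I T) {e f : M.E} (he : M.IsTransition e)
    (hf : M.IsTransition f) (hef : M.SameComp (M.tgt e) (M.tgt f)) : e = f := by
  have hfT := h.mem_of_isTransition hf
  rcases (h.reachIn_of_isTransition he hef.1).eq_or_last with h₁ | ⟨g, hg, hgf, h₁⟩
  · exact h.inj e (h.mem_of_isTransition he) f hfT h₁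
  · obtain rfl := h.inj g hg f hfT hgf
    exact absurd ⟨Reach.edge g, hef.2.trans h₁.reach⟩ hf

end BackTree

/-! ### Paths in subgraphs -/

theorem Sub.isPathIn_iff (D : M.Sub) (S : Set M.E) {x y : D.toAutomaton.V}
    {p : List D.toAutomaton.E} :
    D.toAutomaton.IsPathIn {f | f.1 ∈ S} x p y ↔
      M.IsPathIn (S ∩ D.edges) x.1 (p.map Subtype.val) y.1 := by
  induction p generalizing x with
  | nil =>
    refine ⟨fun h => ?_, fun h => ?_⟩
    · obtain rfl : x = y := h.1
      exact isPathIn_nil _ _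
    · obtain rfl : x = y := Subtype.ext h.1
      exact isPathIn_nil _ _
  | cons e p ih =>
    refine isPathIn_cons.trans (Iff.trans ?_ (isPathIn_cons (e := e.1)).symm)
    exact and_congr ⟨fun h => congrArg Subtype.val h, fun h => Subtype.ext h⟩
      (and_congr ⟨fun h => ⟨h, e.2⟩, fun h => h.1⟩ ih)

theorem Sub.exists_isPathIn (D : M.Sub) (S : Set M.E) {x y : D.toAutomaton.V} {p : List M.E}
    (hp : M.IsPathIn (S ∩ D.edges) x.1 p y.1) :
    ∃ p' : List D.toAutomaton.E, p'.map Subtype.val = p ∧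
      D.toAutomaton.IsPathIn {f | f.1 ∈ S} x p' y := by
  obtain ⟨p', rfl⟩ : ∃ p' : List {f // f ∈ D.edges}, p'.map Subtype.val = p :=
    ⟨p.attach.map fun f => ⟨f.1, (hp.2 f.1 f.2).2⟩, by simp⟩
  exact ⟨p', rfl, (D.isPathIn_iff S).2 hp⟩

theorem Sub.reachIn_iff (D : M.Sub) (S : Set M.E) {x y : D.toAutomaton.V} :
    D.toAutomaton.ReachIn {f | f.1 ∈ S} x y ↔ M.ReachIn (S ∩ D.edges) x.1 y.1 := by
  constructor
  · rintro ⟨p, hp⟩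
    exact ⟨_, (D.isPathIn_iff S).1 hp⟩
  · rintro ⟨p, hp⟩
    obtain ⟨p', -, h⟩ := D.exists_isPathIn S hp
    exact ⟨p', h⟩

theorem Sub.reach_iff (D : M.Sub) {x y : D.toAutomaton.V} :
    D.toAutomaton.Reach x y ↔ M.ReachIn D.edges x.1 y.1 := by
  rw [← reachIn_univ, ← Set.univ_inter D.edges, ← D.reachIn_iff]
  rfl

/-! ### Languages restricted to a set of edges -/

/-- The words labelling a path from `x` to `y` all of whose edges lie in `S`. -/
def languageIn (M : Automaton.{u, v} A) (S : Set M.E) (x y : M.V) : Language A :=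
  {w | ∃ p, M.IsPathIn S x p y ∧ p.map M.lab = w}

theorem mem_languageIn {S : Set M.E} {x y : M.V} {w : List A} :
    w ∈ M.languageIn S x y ↔ ∃ p, M.IsPathIn S x p y ∧ p.map M.lab = w := Iff.rfl

theorem languageIn_univ (x y : M.V) : M.languageIn Set.univ x y = M.language x y := by
  ext w
  rw [mem_languageIn]
  simp only [isPathIn_univ]
  rfl

theorem Sub.languageIn_eq (D : M.Sub) (S : Set M.E) (x y : D.toAutomaton.V) :
    D.toAutomaton.languageIn {f | f.1 ∈ S} x y = M.languageIn (S ∩ D.edges) x.1 y.1 := by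
  ext w
  constructor
  · rintro ⟨p, hp, rfl⟩
    exact ⟨_, (D.isPathIn_iff S).1 hp, List.map_map⟩
  · rintro ⟨p, hp, rfl⟩
    obtain ⟨p', rfl, h⟩ := D.exists_isPathIn S hp
    exact ⟨p', h, (List.map_map (l := p') (f := Subtype.val) (g := M.lab)).symm⟩

theorem Sub.language_eq (D : M.Sub) (x y : D.toAutomaton.V) :
    D.toAutomaton.language x y = M.languageIn D.edges x.1 y.1 := by
  rw [← languageIn_univ, ← Set.univ_inter D.edges, ← D.languageIn_eq]
  rfl

/-- A path may be restricted to a smaller edge set that contains all edges lying on some path with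
the same endpoints. -/
theorem IsPathIn.restrict {S S' : Set M.E} {x y : M.V} {p : List M.E} (hp : M.IsPathIn S x p y)
    (h : ∀ e ∈ S, M.ReachIn S x (M.src e) → M.ReachIn S (M.tgt e) y → e ∈ S') :
    M.IsPathIn S' x p y :=
  ⟨hp.1, fun e he => h e (hp.split_mem he).1 (hp.split_mem he).2.1 (hp.split_mem he).2.2⟩

theorem ReachIn.restrict {S S' : Set M.E} {x y : M.V} (hp : M.ReachIn S x y)
    (h : ∀ e ∈ S, M.ReachIn S x (M.src e) → M.ReachIn S (M.tgt e) y → e ∈ S') :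
    M.ReachIn S' x y :=
  hp.imp fun _ k => k.restrict h

theorem languageIn_congr {S S' : Set M.E} {x y : M.V} (hS : S' ⊆ S)
    (h : ∀ e ∈ S, M.ReachIn S x (M.src e) → M.ReachIn S (M.tgt e) y → e ∈ S') :
    M.languageIn S' x y = M.languageIn S x y := by
  ext w
  exact ⟨fun ⟨p, hp, hw⟩ => ⟨p, hp.mono hS, hw⟩, fun ⟨p, hp, hw⟩ => ⟨p, hp.restrict h, hw⟩⟩

/-- For a back edge of `D`, the tree path from its target to its source is a tail of the tree path
from `x` to its source, hence lies in `D`. A tree edge of `D` into `x` would close a circuit in `T`.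
-/
theorem BackTree.sub {I : M.V} {T : Set M.E} (h : M.BackTree I T) (D : M.Sub) {x : M.V}
    (hx : x ∈ D.verts) (hD : ∀ y ∈ D.verts, M.ReachIn (T ∩ D.edges) x y) :
    D.toAutomaton.BackTree ⟨x, hx⟩ {f | f.1 ∈ T} where
  span y := (D.reachIn_iff T).2 (hD y.1 y.2)
  inj e he f hf hef := Subtype.ext (h.inj e.1 he f.1 hf (congrArg Subtype.val hef))
  root e he hex := by
    refine h.not_reachIn_src he ?_
    have : M.tgt e.1 = x := congrArg Subtype.val hex
    rw [this]
    exact (hD _ (D.src_mem e.1 e.2)).mono Set.inter_subset_left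
  back e he := by
    rw [D.reachIn_iff T]
    obtain ⟨s, hs⟩ := h.back e.1 he
    obtain ⟨t, ht⟩ := hD _ (D.tgt_mem e.1 e.2)
    obtain ⟨t', ht'⟩ := hD _ (D.src_mem e.1 e.2)
    have := h.eq_of_isPathIn
      (isPathIn_append.2 ⟨_, ht.mono Set.inter_subset_left, hs⟩) (ht'.mono Set.inter_subset_left)
    rw [← this] at ht'
    exact ⟨s, hs.1, fun f hf => ht'.2 f (List.mem_append_right _ hf)⟩

/-! ### Rank functions -/

/-- On the set `B` of edges, `r` maps the edges ending at any given vertex bijectively to an initial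
segment of the natural numbers. -/
structure RankOn (M : Automaton.{u, v} A) (B : Set M.E) (r : M.E → ℕ) : Prop where
  inj : ∀ f ∈ B, ∀ g ∈ B, M.tgt f = M.tgt g → r f = r g → f = g
  down : ∀ f ∈ B, ∀ k < r f, ∃ g ∈ B, M.tgt g = M.tgt f ∧ r g = k

theorem IsGeometricRank.rankOn {I : M.V} {r : M.E → ℕ} (h : M.IsGeometricRank I r) :
    M.RankOn {e | M.Bold I e} r where
  inj f hf g hg hfg hr := (h (M.tgt g)).injOn ⟨hf, hfg⟩ ⟨hg, rfl⟩ hr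
  down f hf k hk := by
    obtain ⟨g, ⟨h₁, h₂⟩, h₃⟩ := (h (M.tgt f)).surjOn
      (Set.mem_Iio.2 (hk.trans ((h (M.tgt f)).mapsTo ⟨hf, rfl⟩)))
    exact ⟨g, h₁, h₂, h₃⟩

/-- Only edges of smaller rank with the same target have to survive. The set `B'` may be smaller
than `B` because in a cut sloop the edges into the cut vertex stop being bold. -/
theorem RankOn.sub {B : Set M.E} {r : M.E → ℕ} (h : M.RankOn B r) (D : M.Sub) {B' : Set M.E}
    (hB' : B' ⊆ B)
    (hD : ∀ f ∈ B', f ∈ D.edges → ∀ g ∈ B, M.tgt g = M.tgt f → r g < r f → g ∈ B' ∧ g ∈ D.edges) :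
    D.toAutomaton.RankOn {f | f.1 ∈ B'} (D.rank r) where
  inj f hf g hg hfg hr :=
    Subtype.ext (h.inj f.1 (hB' hf) g.1 (hB' hg) (congrArg Subtype.val hfg) hr)
  down f hf k hk := by
    obtain ⟨g, h₁, h₂, rfl⟩ := h.down f.1 (hB' hf) k hk
    have := hD f.1 hf f.2 g h₁ h₂ hk
    exact ⟨⟨g, this.2⟩, this.1, Subtype.ext h₂, rfl⟩

/-! ### Cutting -/

theorem cut_tgt_of_ne {x : M.V} {e : M.E} (h : M.tgt e ≠ x) :
    (M.cut x).tgt e = Sum.inl (M.tgt e) := dif_neg h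

theorem cut_tgt_of_eq {x : M.V} {e : M.E} (h : M.tgt e = x) :
    (M.cut x).tgt e = Sum.inr ⟨e, h⟩ := dif_pos h

theorem cut_isPath_inl {x a b : M.V} {p : List M.E} :
    (M.cut x).IsPath (Sum.inl a) p (Sum.inl b) ↔ M.IsPathIn {f | M.tgt f ≠ x} a p b := by
  induction p using List.reverseRecOn generalizing b with
  | nil =>
    refine ⟨fun h => ?_, fun h => congrArg Sum.inl h.1⟩
    obtain rfl : a = b := Sum.inl.inj h
    exact isPathIn_nil _ _
  | append_singleton p e ih =>
    have key : (M.cut x).tgt e = Sum.inl b ↔ M.tgt e ≠ x ∧ M.tgt e = b := by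
      by_cases h : M.tgt e = x
      · rw [cut_tgt_of_eq h]
        exact ⟨fun k => (Sum.inr_ne_inl k).elim, fun k => absurd h k.1⟩
      · rw [cut_tgt_of_ne h]
        exact ⟨fun k => ⟨h, Sum.inl.inj k⟩, fun k => congrArg Sum.inl k.2⟩
    exact (isPath_concat (M := M.cut x)).trans ((and_congr ih key).trans isPathIn_concat.symm)

/-- No edge leaves a new vertex, and only its own edge enters it, so that edge comes last and all
earlier ones avoid `x`. -/
theorem cut_isPath_inr {x a : M.V} {e : {e : M.E // M.tgt e = x}} {p : List M.E} :
    (M.cut x).IsPath (Sum.inl a) p (Sum.inr e) ↔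
      ∃ p', p = p' ++ [e.1] ∧ M.IsPathIn {f | M.tgt f ≠ x} a p' (M.src e.1) := by
  rcases List.eq_nil_or_concat p with rfl | ⟨p, f, rfl⟩
  · refine ⟨fun h => ?_, fun ⟨p', h, _⟩ => by simp at h⟩
    cases (show (Sum.inl a : M.V ⊕ {e : M.E // M.tgt e = x}) = Sum.inr e from h)
  · rw [List.concat_eq_append]
    refine (isPath_concat (M := M.cut x)).trans ?_
    constructor
    · rintro ⟨h₁, h₂⟩
      by_cases h : M.tgt f = x
      · rw [cut_tgt_of_eq h] at h₂
        obtain rfl := Sum.inr.inj h₂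
        exact ⟨p, rfl, cut_isPath_inl.1 h₁⟩
      · rw [cut_tgt_of_ne h] at h₂
        cases h₂
    · rintro ⟨p', h₁, h₂⟩
      obtain ⟨rfl, h₃⟩ := List.append_inj' h₁ rfl
      obtain rfl : f = e.1 := by simpa using h₃
      exact ⟨cut_isPath_inl.2 h₂, cut_tgt_of_eq e.2⟩

theorem cut_reachIn {x a b : M.V} {S S' : Set M.E} (hS : S ⊆ S') (hSx : ∀ e ∈ S, M.tgt e ≠ x)
    (h : M.ReachIn S a b) : (M.cut x).ReachIn S' (Sum.inl a) (Sum.inl b) := by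
  obtain ⟨p, hp⟩ := h
  exact ⟨p, cut_isPath_inl.2 (hp.mono hSx), fun e he => hS (hp.2 e he)⟩

/-- Each edge into the root now ends at a leaf of its own, so it joins the tree; the remaining back
edges keep their tree paths, which never enter the root. -/
theorem BackTree.cut {I : M.V} {T : Set M.E} (h : M.BackTree I T) :
    (M.cut I).BackTree (Sum.inl I) (T ∪ {f | M.tgt f = I}) where
  span x := by
    rcases x with x | ⟨f, hf⟩
    · exact cut_reachIn Set.subset_union_left h.root (h.span x)
    · refine (cut_reachIn Set.subset_union_left h.root (h.span (M.src f))).trans ?_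
      rw [← cut_tgt_of_eq hf]
      exact ReachIn.edge (M := M.cut I) (e := f) (Or.inr hf)
  inj e he f hf hef := by
    by_cases h₁ : M.tgt e = I <;> by_cases h₂ : M.tgt f = I
    · rw [cut_tgt_of_eq h₁, cut_tgt_of_eq h₂] at hef
      exact congrArg Subtype.val (Sum.inr.inj hef)
    · rw [cut_tgt_of_eq h₁, cut_tgt_of_ne h₂] at hef
      cases hef
    · rw [cut_tgt_of_ne h₁, cut_tgt_of_eq h₂] at hef
      cases hef
    · rw [cut_tgt_of_ne h₁, cut_tgt_of_ne h₂] at hef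
      exact h.inj e (he.resolve_right h₁) f (hf.resolve_right h₂) (Sum.inl.inj hef)
  root e _ heI := by
    by_cases h₁ : M.tgt e = I
    · rw [cut_tgt_of_eq h₁] at heI
      cases heI
    · rw [cut_tgt_of_ne h₁] at heI
      exact h₁ (Sum.inl.inj heI)
  back e he := by
    replace he := not_or.1 he
    rw [cut_tgt_of_ne he.2]
    exact cut_reachIn Set.subset_union_left h.root (h.back e he.1)

theorem RankOn.cut {x : M.V} {B : Set M.E} {r : M.E → ℕ} (h : M.RankOn B r)
    (hB : ∀ f ∈ B, M.tgt f ≠ x) : (M.cut x).RankOn B r where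
  inj f hf g hg hfg hr := by
    rw [cut_tgt_of_ne (hB f hf), cut_tgt_of_ne (hB g hg)] at hfg
    exact h.inj f hf g hg (Sum.inl.inj hfg) hr
  down f hf k hk := by
    obtain ⟨g, h₁, h₂, h₃⟩ := h.down f hf k hk
    refine ⟨g, h₁, ?_, h₃⟩
    rw [cut_tgt_of_ne (hB f hf), cut_tgt_of_ne (hB g h₁), h₂]

theorem cut_language {x a : M.V} (e : {e : M.E // M.tgt e = x}) :
    (M.cut x).language (Sum.inl a) (Sum.inr e) =
      M.languageIn {f | M.tgt f ≠ x} a (M.src e.1) * {[M.lab e.1]} := by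
  ext w
  rw [Language.mem_mul]
  constructor
  · rintro ⟨p, hp, rfl⟩
    obtain ⟨p', rfl, h⟩ := cut_isPath_inr.1 hp
    exact ⟨_, ⟨p', h, rfl⟩, _, rfl,
      (List.map_append (f := M.lab) (l₁ := p') (l₂ := [e.1])).symm⟩
  · rintro ⟨_, ⟨p, hp, rfl⟩, _, rfl, rfl⟩
    exact ⟨_, cut_isPath_inr.2 ⟨p, rfl, hp⟩, List.map_append (f := M.lab)⟩

/-! ### Closures with respect to the root -/

section Closure

variable {I s : M.V} {T R : Set M.E} {D : M.Sub}

/-- The subgraph of all vertices from which `s` can be reached without returning to `I`, and of the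
edges on the paths that do so, together with a set `R` of edges from `s` to `I`. -/
def avoiding (M : Automaton.{u, v} A) (I s : M.V) (R : Set M.E)
    (hs : M.ReachIn {f | M.tgt f ≠ I} I s) (hR : ∀ f ∈ R, M.src f = s ∧ M.tgt f = I) : M.Sub where
  verts := {y | M.ReachIn {f | M.tgt f ≠ I} y s}
  edges := {f | M.tgt f ≠ I ∧ M.ReachIn {f | M.tgt f ≠ I} (M.tgt f) s} ∪ R
  src_mem f hf := by
    rcases hf with hf | hf
    · exact (ReachIn.edge hf.1).trans hf.2
    · rw [(hR f hf).1]
      exact ReachIn.refl _ _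
  tgt_mem f hf := by
    rcases hf with hf | hf
    · exact hf.2
    · rw [(hR f hf).2]
      exact hs

theorem BackTree.geodesic_le_avoiding (h : M.BackTree I T)
    (hs : M.ReachIn {f | M.tgt f ≠ I} I s) (hR : ∀ f ∈ R, M.src f = s ∧ M.tgt f = I) {y : M.V}
    (hy : M.ReachIn {f | M.tgt f ≠ I} y s) :
    (M.geodesic I I y).Le (M.avoiding I s R hs hR) := by
  have key : ∀ p, M.IsPathIn T I p y → ∀ e ∈ p, e ∈ (M.avoiding I s R hs hR).edges := by
    intro p hp e he
    have := hp.split_mem he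
    exact Or.inl ⟨h.root e this.1, (h.reachIn_ne_root this.2.2).trans hy⟩
  rw [← h.treeEdges_eq] at key
  constructor
  · rintro z (rfl | rfl | ⟨p, hp, e, he, rfl | rfl⟩)
    · exact hs
    · exact hy
    · exact Sub.src_mem _ _ (key p hp e he)
    · exact Sub.tgt_mem _ _ (key p hp e he)
  · rintro e ⟨p, hp, he⟩
    exact key p hp e he

theorem BackTree.closed_avoiding (h : M.BackTree I T) (hs : M.ReachIn {f | M.tgt f ≠ I} I s)
    (hR : ∀ f ∈ R, M.src f = s ∧ M.tgt f = I) : M.Closed I I (M.avoiding I s R hs hR) := by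
  refine ⟨⟨hs, fun y _ => ?_⟩, fun y hy => h.geodesic_le_avoiding hs hR hy, fun e _ he hy =>
    Or.inl ⟨he, hy⟩⟩
  rw [h.treeEdges_eq]
  exact h.span y

/-- Bold edges are present by closedness, tree edges as last edges of geodesics. A closed subgraph
can therefore be traced backwards along any path that does not return to `I`. -/
theorem BackTree.mem_of_closed (h : M.BackTree I T) {D' : M.Sub} (hD' : M.Closed I I D') {f : M.E}
    (hf : M.tgt f ≠ I) (hfD : M.tgt f ∈ D'.verts) : f ∈ D'.edges := by
  by_cases hT : f ∈ T
  · obtain ⟨p, hp⟩ := h.span (M.src f)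
    refine (hD'.2.1 _ hfD).2 ⟨p ++ [f], ?_, by simp⟩
    rw [h.treeEdges_eq]
    exact isPathIn_concat.2 ⟨hp, hT, rfl⟩
  · exact hD'.2.2 f (h.bold_iff.2 hT) hf hfD

theorem BackTree.mem_verts_of_closed (h : M.BackTree I T) {D' : M.Sub} (hD' : M.Closed I I D')
    (hs : s ∈ D'.verts) {y : M.V} (hy : M.ReachIn {f | M.tgt f ≠ I} y s) : y ∈ D'.verts := by
  obtain ⟨p, hp⟩ := hy
  induction p generalizing y with
  | nil =>
    obtain rfl : y = s := hp.1
    exact hs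
  | cons f p ih =>
    obtain ⟨rfl, h₁, h₂⟩ := isPathIn_cons.1 hp
    exact D'.src_mem f (h.mem_of_closed hD' h₁ (ih h₂))

/-- This makes closures explicit. With `R` empty it serves the geodesic; with `R = {e}` it serves
the loop of `e`, whose last edge ends at the root and is not forced by closedness. -/
theorem BackTree.closure_eq (h : M.BackTree I T) (hs : M.ReachIn {f | M.tgt f ≠ I} I s)
    (hR : ∀ f ∈ R, M.src f = s ∧ M.tgt f = I) (hsD : s ∈ D.verts) (hRD : R ⊆ D.edges)
    (hD : D.Le (M.avoiding I s R hs hR)) : M.closure I I D = M.avoiding I s R hs hR := by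
  have hv : (M.closure I I D).verts = (M.avoiding I s R hs hR).verts :=
    Set.Subset.antisymm (fun y hy => hy _ (h.closed_avoiding hs hR) hD)
      fun y hy D' hD' hle => h.mem_verts_of_closed hD' (hle.1 hsD) hy
  have he : (M.closure I I D).edges = (M.avoiding I s R hs hR).edges := by
    refine Set.Subset.antisymm (fun y hy => hy _ (h.closed_avoiding hs hR) hD) ?_
    rintro f (hf | hf) D' hD' hle
    · exact h.mem_of_closed hD' hf.1 (h.mem_verts_of_closed hD' (hle.1 hsD) hf.2)
    · exact hle.2 (hRD hf)
  cases hc : M.closure I I D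
  cases ha : M.avoiding I s R hs hR
  rw [hc, ha] at hv he
  simp only at hv he
  subst hv he
  rfl

theorem BackTree.geodesicClosure_eq (h : M.BackTree I T) (q : M.V) :
    M.geodesicClosure I q = M.avoiding I q ∅ (h.reachIn_ne_root (h.span q))
      (fun _ hf => absurd hf (Set.notMem_empty _)) :=
  h.closure_eq _ _ (Or.inr (Or.inl rfl)) (Set.empty_subset _)
    (h.geodesic_le_avoiding _ _ (ReachIn.refl _ _))

theorem BackTree.loopClosure_eq {e : M.E} (h : M.BackTree (M.tgt e) T) :
    M.loopClosure (M.tgt e) e = M.avoiding (M.tgt e) (M.src e) {e}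
      (h.reachIn_ne_root (h.span _)) (by rintro _ rfl; exact ⟨rfl, rfl⟩) := by
  refine h.closure_eq _ _ (Or.inr (Or.inl rfl)) (by rintro _ rfl; exact Set.mem_insert _ _) ?_
  have := h.geodesic_le_avoiding (R := {e}) (h.reachIn_ne_root (h.span (M.src e)))
    (by rintro _ rfl; exact ⟨rfl, rfl⟩) (ReachIn.refl _ _)
  refine ⟨this.1, ?_⟩
  rintro f (rfl | hf)
  · exact Or.inr rfl
  · exact this.2 hf

end Closure

/-! ### Decompositions of languages -/

theorem append_mem_languageIn {S : Set M.E} {x y z : M.V} {v w : List A}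
    (hv : v ∈ M.languageIn S x y) (hw : w ∈ M.languageIn S y z) : v ++ w ∈ M.languageIn S x z := by
  obtain ⟨p, hp, rfl⟩ := hv
  obtain ⟨p', hp', rfl⟩ := hw
  exact ⟨p ++ p', isPathIn_append.2 ⟨y, hp, hp'⟩, List.map_append⟩

theorem languageIn_mul_le (S : Set M.E) (x y z : M.V) :
    M.languageIn S x y * M.languageIn S y z ≤ M.languageIn S x z := by
  intro w hw
  obtain ⟨a, ha, b, hb, rfl⟩ := Language.mem_mul.1 hw
  exact append_mem_languageIn ha hb

theorem languageIn_mono {S S' : Set M.E} (h : S ⊆ S') (x y : M.V) :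
    M.languageIn S x y ≤ M.languageIn S' x y := fun _ ⟨p, hp, hw⟩ => ⟨p, hp.mono h, hw⟩

theorem nil_mem_languageIn (S : Set M.E) (x : M.V) : [] ∈ M.languageIn S x x :=
  ⟨[], isPathIn_nil S x, rfl⟩

theorem lab_mem_languageIn {S : Set M.E} {e : M.E} (he : e ∈ S) :
    [M.lab e] ∈ M.languageIn S (M.src e) (M.tgt e) :=
  ⟨[e], isPathIn_cons.2 ⟨rfl, he, isPathIn_nil _ _⟩, rfl⟩

/-- Every factor on the left labels paths that compose, which gives one inclusion. For the other, a
path is built up edge by edge at its end: an edge not ending at the root extends the last factor,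
the edge `e` completes a new block of the star, and any other edge into the root completes a circuit
absorbed by the preceding `P`. -/
theorem loop_decomposition (e : M.E) (q : M.V) :
    M.languageIn {e}ᶜ (M.tgt e) (M.tgt e) *
      (M.languageIn {f | M.tgt f ≠ M.tgt e} (M.tgt e) (M.src e) * {[M.lab e]} *
        M.languageIn {e}ᶜ (M.tgt e) (M.tgt e))∗ *
      M.languageIn {f | M.tgt f ≠ M.tgt e} (M.tgt e) q = M.language (M.tgt e) q := by
  have hsub : {f | M.tgt f ≠ M.tgt e} ⊆ ({e}ᶜ : Set M.E) := by
    rintro f hf rfl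
    exact hf rfl
  set I := M.tgt e with hI
  set P := M.languageIn {e}ᶜ I I with hP
  set Q := M.languageIn {f | M.tgt f ≠ I} I (M.src e) * ({[M.lab e]} : Language A) with hQ
  have hPP : P * P ≤ P := languageIn_mul_le _ _ _ _
  apply le_antisymm
  · rw [← languageIn_univ]
    have hP' : P ≤ M.languageIn Set.univ I I := languageIn_mono (Set.subset_univ _) _ _
    have hQ' : Q ≤ M.languageIn Set.univ I I := by
      intro w hw
      obtain ⟨a, ha, b, rfl, rfl⟩ := Language.mem_mul.1 hw
      exact append_mem_languageIn (languageIn_mono (Set.subset_univ _) _ _ ha)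
        (lab_mem_languageIn (Set.mem_univ e))
    have hC := languageIn_mul_le (M := M) Set.univ I I I
    have hQP : Q * P ≤ M.languageIn Set.univ I I := (mul_le_mul' hQ' hP').trans hC
    refine (mul_le_mul' (mul_kstar_le hP' ?_) (languageIn_mono (Set.subset_univ _) I q)).trans
      (languageIn_mul_le _ _ _ _)
    exact (mul_le_mul' le_rfl hQP).trans hC
  · rintro w ⟨p, hp, rfl⟩
    induction p using List.reverseRecOn generalizing q with
    | nil =>
      obtain rfl : I = q := hp
      refine Language.append_mem_mul (a := []) (b := []) ?_ (nil_mem_languageIn _ _)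
      exact Language.append_mem_mul (a := []) (b := []) (nil_mem_languageIn _ _)
        (Language.nil_mem_kstar _)
    | append_singleton p f ih =>
      obtain ⟨h₁, rfl⟩ := isPath_concat.1 hp
      obtain ⟨a, ha, b, hb, hab⟩ := Language.mem_mul.1 (ih _ h₁)
      rw [List.map_append, ← hab, List.append_assoc]
      by_cases hf : M.tgt f = I
      · rw [← List.append_nil (a ++ (b ++ _))]
        refine Language.append_mem_mul ?_ (hf ▸ nil_mem_languageIn _ _)
        by_cases hfe : f = e
        · have hbe : b ++ List.map M.lab [f] ∈ Q := by
            subst hfe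
            exact Language.append_mem_mul hb rfl
          have hle : P * (Q * P)∗ * (Q * P) ≤ P * (Q * P)∗ := by
            rw [mul_assoc]
            exact mul_le_mul' le_rfl kstar_mul_le_kstar
          refine hle (Language.append_mem_mul ha ?_)
          rw [← List.append_nil (b ++ _)]
          exact Language.append_mem_mul hbe (nil_mem_languageIn _ _)
        · have hbe : b ++ List.map M.lab [f] ∈ P := by
            refine append_mem_languageIn (languageIn_mono hsub _ _ hb) ?_
            have := lab_mem_languageIn (M := M) (S := {e}ᶜ) hfe
            rwa [hf] at this
          -- Unroll the star at its right end: the extra `P` merges with the leading `P` if there is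
          -- no block, and with the `P` of the last block otherwise.
          have hle : P * (Q * P)∗ * P ≤ P * (Q * P)∗ := by
            conv_lhs => rw [← one_add_kstar_mul (a := Q * P)]
            rw [mul_add, add_mul, mul_one]
            refine add_le (hPP.trans ?_) ?_
            · exact le_mul_of_one_le_right' one_le_kstar
            · have hQPP : Q * P * P ≤ Q * P :=
                (mul_assoc Q P P).trans_le (mul_le_mul' le_rfl hPP)
              have hstar := (mul_le_mul' (le_refl (Q * P)∗) hQPP).trans kstar_mul_le_kstar
              rw [mul_assoc P, mul_assoc (Q * P)∗]
              exact mul_le_mul' le_rfl hstar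
          exact hle (Language.append_mem_mul ha hbe)
      · exact Language.append_mem_mul ha (append_mem_languageIn hb (lab_mem_languageIn hf))

/-- The edge is the first one whose target lies in the component of `q`. -/
theorem exists_entering {x q : M.V} {p : List M.E} (hp : M.IsPath x p q) (hx : ¬ M.SameComp x q) :
    ∃ p₁ e p₂, p = p₁ ++ [e] ++ p₂ ∧ M.IsPath x p₁ (M.src e) ∧ M.IsPath (M.tgt e) p₂ q ∧
      M.IsTransition e ∧ M.SameComp q (M.tgt e) := by
  induction p generalizing x with
  | nil =>
    obtain rfl : x = q := hp
    exact absurd ⟨Reach.refl x, Reach.refl x⟩ hx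
  | cons e p ih =>
    obtain ⟨rfl, hp⟩ := hp
    by_cases h : M.SameComp (M.tgt e) q
    · exact ⟨[], e, p, rfl, rfl, hp, fun h' => hx (h'.trans h), h.symm⟩
    · obtain ⟨p₁, f, p₂, rfl, h₁, h₂, h₃, h₄⟩ := ih hp h
      exact ⟨e :: p₁, f, p₂, rfl, ⟨rfl, h₁⟩, h₂, h₃, h₄⟩

theorem BackTree.elementary_decomposition {I q : M.V} {T : Set M.E} (h : M.BackTree I T) {e : M.E}
    (he : M.IsTransition e) (hI : M.Reach I (M.src e)) (hq : M.SameComp q (M.tgt e)) :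
    M.language I (M.src e) * {[M.lab e]} * M.language (M.tgt e) q = M.language I q := by
  have hIq : ¬ M.SameComp I q := fun hIq => he ⟨Reach.edge e, hq.2.trans (hIq.2.trans hI)⟩
  simp only [← languageIn_univ]
  apply le_antisymm
  · intro w hw
    obtain ⟨_, hab, c, hc, rfl⟩ := Language.mem_mul.1 hw
    obtain ⟨a, ha, b, rfl, rfl⟩ := Language.mem_mul.1 hab
    exact append_mem_languageIn (append_mem_languageIn ha (lab_mem_languageIn (Set.mem_univ e))) hc
  · rintro w ⟨p, hp, rfl⟩
    obtain ⟨p₁, f, p₂, rfl, h₁, h₂, h₃, h₄⟩ := exists_entering hp.1 hIq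
    obtain rfl := h.eq_of_isTransition he h₃ (hq.symm.trans h₄)
    rw [List.map_append, List.map_append]
    exact Language.append_mem_mul
      (Language.append_mem_mul ⟨p₁, isPathIn_univ.2 h₁, rfl⟩ rfl) ⟨p₂, isPathIn_univ.2 h₂, rfl⟩

/-! ### The subautomata of the recursion -/

section Parts

variable {I q : M.V} {T : Set M.E} {r : M.E → ℕ}

theorem Sub.card_edges_le [Finite M.E] (D : M.Sub) :
    Nat.card D.toAutomaton.E ≤ Nat.card M.E :=
  Nat.card_le_card_of_injective (Subtype.val : {f // f ∈ D.edges} → M.E) Subtype.val_injective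

theorem Sub.ncard_le_of_subset [Finite M.E] (D : M.Sub) {B' : Set D.toAutomaton.E} {B : Set M.E}
    (h : ∀ f ∈ B', f.1 ∈ B) : B'.ncard ≤ B.ncard :=
  Set.ncard_le_ncard_of_injOn Subtype.val h (Subtype.val_injective.injOn)

theorem Sub.size_lt [Finite M.E] (D : M.Sub) {e : M.E} (he : e ∉ D.edges) (T : Set M.E) :
    Nat.card D.toAutomaton.E + {f : D.toAutomaton.E | f.1 ∈ T}ᶜ.ncard <
      Nat.card M.E + Tᶜ.ncard := by
  refine add_lt_add_of_lt_of_le ?_ (D.ncard_le_of_subset fun f hf => hf)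
  have : Nat.card D.toAutomaton.E = D.edges.ncard := rfl
  rw [this, ← Set.ncard_univ]
  exact Set.ncard_lt_ncard ((Set.ssubset_univ_iff).2 fun h => he (h ▸ Set.mem_univ e))

/-! ### Languages of the parts -/

theorem above_language (hI : M.Reach I q) :
    (M.above q).toAutomaton.language ⟨I, mem_above hI⟩ ⟨q, M.self_mem_above q⟩ =
      M.language I q := by
  refine (Sub.language_eq _ _ _).trans (Eq.trans ?_ (languageIn_univ I q))
  refine languageIn_congr (Set.subset_univ _) fun f _ _ hf => ?_
  rw [reachIn_univ] at hf
  exact ⟨trivial, (Reach.edge f).trans hf, hf⟩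

theorem strongComp_language {p : M.V} (hq : M.SameComp q p) :
    (M.strongComp p).toAutomaton.language ⟨p, M.self_mem_strongComp p⟩ ⟨q, mem_strongComp hq⟩ =
      M.language p q := by
  refine (Sub.language_eq _ _ _).trans (Eq.trans ?_ (languageIn_univ p q))
  refine languageIn_congr (Set.subset_univ _) fun f _ hf₁ hf₂ => ?_
  rw [reachIn_univ] at hf₁ hf₂
  exact ⟨trivial, ⟨(Reach.edge f).trans (hf₂.trans hq.1), hf₁⟩,
    ⟨hf₂.trans hq.1, hf₁.trans (Reach.edge f)⟩⟩

theorem mem_removeComp_of_reachIn {e f : M.E} (hf : f ∈ ({e}ᶜ : Set M.E))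
    (h₁ : M.ReachIn {e}ᶜ I (M.src f)) (h₂ : M.ReachIn {e}ᶜ (M.tgt f) I) :
    f ∈ (M.removeComp e I).edges :=
  ⟨hf, ⟨(ReachIn.edge hf).trans h₂, h₁⟩, h₂, h₁.trans (ReachIn.edge hf)⟩

theorem removeComp_language (e : M.E) (I : M.V) :
    (M.removeComp e I).toAutomaton.language ⟨I, M.self_mem_removeComp e I⟩
      ⟨I, M.self_mem_removeComp e I⟩ = M.languageIn {e}ᶜ I I :=
  (Sub.language_eq _ _ _).trans
    (languageIn_congr (fun _ hf => hf.1) fun _ hf h₁ h₂ => mem_removeComp_of_reachIn hf h₁ h₂)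

namespace BackTree

theorem mem_geodesicClosure_verts (h : M.BackTree I T) {y : M.V} :
    y ∈ (M.geodesicClosure I q).verts ↔ M.ReachIn {f | M.tgt f ≠ I} y q := by
  rw [h.geodesicClosure_eq]
  rfl

theorem mem_geodesicClosure_edges (h : M.BackTree I T) {f : M.E} :
    f ∈ (M.geodesicClosure I q).edges ↔
      M.tgt f ≠ I ∧ M.ReachIn {f | M.tgt f ≠ I} (M.tgt f) q := by
  rw [h.geodesicClosure_eq]
  exact or_iff_left (Set.notMem_empty _)

theorem mem_loopClosure_verts {e : M.E} (h : M.BackTree (M.tgt e) T) {y : M.V} :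
    y ∈ (M.loopClosure (M.tgt e) e).verts ↔
      M.ReachIn {f | M.tgt f ≠ M.tgt e} y (M.src e) := by
  rw [h.loopClosure_eq]
  rfl

theorem mem_loopClosure_edges {e : M.E} (h : M.BackTree (M.tgt e) T) {f : M.E} :
    f ∈ (M.loopClosure (M.tgt e) e).edges ↔
      (M.tgt f ≠ M.tgt e ∧ M.ReachIn {f | M.tgt f ≠ M.tgt e} (M.tgt f) (M.src e)) ∨ f = e := by
  rw [h.loopClosure_eq]
  rfl

theorem geodesicClosure_language (h : M.BackTree I T) (q : M.V) :
    (M.geodesicClosure I q).toAutomaton.language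
      ⟨I, M.self_mem_closure I I (M.geodesic I I q)⟩ ⟨q, M.terminal_mem_geodesicClosure I q⟩ =
      M.languageIn {f | M.tgt f ≠ I} I q :=
  (Sub.language_eq _ _ _).trans
    (languageIn_congr (fun _ hf => (h.mem_geodesicClosure_edges.1 hf).1) fun _ hf _ h₂ =>
      h.mem_geodesicClosure_edges.2 ⟨hf, h₂⟩)

end BackTree

theorem loopClosure_tgt_ne (e : M.E) :
    {f : (M.loopClosure (M.tgt e) e).toAutomaton.E |
      (M.loopClosure (M.tgt e) e).toAutomaton.tgt f ≠ M.loopClosureBase (M.tgt e) e} =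
      {f | f.1 ∈ {f | M.tgt f ≠ M.tgt e}} := by
  ext f
  exact not_congr ⟨fun h => congrArg Subtype.val h, fun h => Subtype.ext h⟩

theorem BackTree.cutSloop_language {e : M.E} (h : M.BackTree (M.tgt e) T) :
    (M.cutSloop (M.tgt e) e).language (M.cutSloopInit (M.tgt e) e) (M.cutSloopTerm (M.tgt e) e) =
      M.languageIn {f | M.tgt f ≠ M.tgt e} (M.tgt e) (M.src e) * {[M.lab e]} := by
  refine (cut_language (M := (M.loopClosure (M.tgt e) e).toAutomaton) _).trans ?_
  rw [loopClosure_tgt_ne]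
  refine congrArg (· * ({[M.lab e]} : Language A)) ((Sub.languageIn_eq _ _ _ _).trans ?_)
  exact languageIn_congr Set.inter_subset_left fun f hf _ h₂ =>
    ⟨hf, h.mem_loopClosure_edges.2 (Or.inl ⟨hf, h₂⟩)⟩

/-- An acceptor to which the recursion applies, with spanning tree `T`. -/
structure Admissible (M : Automaton.{u, v} A) (I q : M.V) (T : Set M.E) (r : M.E → ℕ) : Prop where
  tree : M.BackTree I T
  trim : M.Trim I q
  rank : M.RankOn Tᶜ r

theorem BackTree.sub_admissible (h : M.BackTree I T) (hr : M.RankOn Tᶜ r) (D : M.Sub)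
    {x y : M.V} (hx : x ∈ D.verts) (hy : y ∈ D.verts)
    (hD : ∀ z ∈ D.verts, M.ReachIn (T ∩ D.edges) x z)
    (hD' : ∀ z ∈ D.verts, M.ReachIn D.edges z y)
    (hD'' : ∀ f ∈ D.edges, ∀ g ∉ T, M.tgt g = M.tgt f → r g < r f → g ∈ D.edges) :
    D.toAutomaton.Admissible ⟨x, hx⟩ ⟨y, hy⟩ {f | f.1 ∈ T} (D.rank r) where
  tree := h.sub D hx hD
  trim z := ⟨D.reach_iff.2 ((hD z.1 z.2).mono Set.inter_subset_right), D.reach_iff.2 (hD' z.1 z.2)⟩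
  rank := hr.sub D subset_rfl fun f _ hf g hg hgf hr => ⟨hg, hD'' f hf g hg hgf hr⟩

/-! ### Inheritance of the hypotheses by the parts -/

namespace Admissible

theorem above (h : M.Admissible I q T r) {y : M.V} (hI : M.Reach I y) :
    (M.above y).toAutomaton.Admissible ⟨I, mem_above hI⟩ ⟨y, M.self_mem_above y⟩
      {f | f.1 ∈ T} ((M.above y).rank r) := by
  have key : ∀ f, M.Reach (M.tgt f) y → f ∈ (M.above y).edges :=
    fun f hf => ⟨trivial, (Reach.edge f).trans hf, hf⟩
  refine h.tree.sub_admissible h.rank _ _ _ (fun z hz => ?_) (fun z hz => ?_) ?_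
  · exact (h.tree.span z).restrict fun f hf _ hz' => ⟨hf, key f (hz'.reach.trans hz)⟩
  · exact (reachIn_univ.2 hz).restrict fun f _ _ hz' => key f hz'.reach
  · exact fun f hf g _ hgf _ => key g (hgf ▸ hf.2.2)

theorem strongComp (h : M.Admissible I q T r) {e : M.E} (he : M.IsTransition e)
    (hq : M.SameComp q (M.tgt e)) :
    (M.strongComp (M.tgt e)).toAutomaton.Admissible ⟨M.tgt e, M.self_mem_strongComp (M.tgt e)⟩
      ⟨q, mem_strongComp hq⟩ {f | f.1 ∈ T} ((M.strongComp (M.tgt e)).rank r) := by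
  have key : ∀ f, M.Reach (M.tgt e) (M.src f) → M.Reach (M.tgt f) (M.tgt e) →
      f ∈ (M.strongComp (M.tgt e)).edges := fun f h₁ h₂ =>
    ⟨trivial, ⟨(Reach.edge f).trans h₂, h₁⟩, h₂, h₁.trans (Reach.edge f)⟩
  refine h.tree.sub_admissible h.rank _ _ _ (fun z hz => ?_) (fun z hz => ?_) ?_
  · exact (h.tree.reachIn_of_isTransition he hz.2).restrict fun f hf h₁ h₂ =>
      ⟨hf, key f h₁.reach (h₂.reach.trans hz.1)⟩
  · exact (reachIn_univ.2 (hz.1.trans hq.2)).restrict fun f _ h₁ h₂ =>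
      key f (hz.2.trans h₁.reach) (h₂.reach.trans hq.1)
  · intro f hf g hg hgf _
    have hgt : M.SameComp (M.tgt g) (M.tgt e) := hgf ▸ hf.2.2
    exact key g (hgt.2.trans (h.tree.back g hg).reach) hgt.1

theorem removeComp {e : M.E} (h : M.Admissible (M.tgt e) q T r) (he : e ∉ T)
    (hmax : ∀ f, f ∉ T → M.tgt f = M.tgt e → r f ≤ r e) :
    (M.removeComp e (M.tgt e)).toAutomaton.Admissible
      ⟨M.tgt e, M.self_mem_removeComp e (M.tgt e)⟩ ⟨M.tgt e, M.self_mem_removeComp e (M.tgt e)⟩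
      {f | f.1 ∈ T} ((M.removeComp e (M.tgt e)).rank r) := by
  have hT : T ⊆ {e}ᶜ := fun f hf hfe => he (hfe ▸ hf)
  refine h.tree.sub_admissible h.rank _ _ _ (fun z hz => ?_) (fun z hz => ?_) ?_
  · exact (h.tree.span z).restrict fun f hf h₁ h₂ =>
      ⟨hf, mem_removeComp_of_reachIn (hT hf) (h₁.mono hT) ((h₂.mono hT).trans hz.1)⟩
  · exact hz.1.restrict fun f hf h₁ h₂ => mem_removeComp_of_reachIn hf (hz.2.trans h₁) h₂
  · intro f hf g hg hgf hlt
    refine mem_removeComp_of_reachIn ?_ ((h.tree.span _).mono hT) (hgf ▸ hf.2.2.1)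
    -- The removed edge is never needed below a surviving one: `f` would end at the root, so it is
    -- not a tree edge, and its rank cannot exceed the maximum.
    rintro rfl
    by_cases hfT : f ∈ T
    · exact h.tree.root f hfT hgf.symm
    · exact absurd (hmax f hfT hgf.symm) (not_le.2 hlt)

theorem geodesicClosure (h : M.Admissible I q T r) (y : M.V) :
    (M.geodesicClosure I y).toAutomaton.Admissible
      ⟨I, M.self_mem_closure I I (M.geodesic I I y)⟩ ⟨y, M.terminal_mem_geodesicClosure I y⟩
      {f | f.1 ∈ T} ((M.geodesicClosure I y).rank r) := by
  refine h.tree.sub_admissible h.rank _ _ _ (fun z hz => ?_) (fun z hz => ?_) ?_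
  · exact (h.tree.span z).restrict fun f hf _ h₂ => ⟨hf, h.tree.mem_geodesicClosure_edges.2
      ⟨h.tree.root f hf, (h.tree.reachIn_ne_root h₂).trans (h.tree.mem_geodesicClosure_verts.1 hz)⟩⟩
  · exact (h.tree.mem_geodesicClosure_verts.1 hz).restrict fun f hf _ h₂ =>
      h.tree.mem_geodesicClosure_edges.2 ⟨hf, h₂⟩
  · intro f hf g _ hgf _
    rw [h.tree.mem_geodesicClosure_edges] at hf ⊢
    rwa [hgf]

/-- In the closure of the loop, `e` is the only edge into the root. Hence cutting creates a single
new vertex, and every old vertex reaches it by going to `src e` without returning and then taking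
`e`. -/
theorem cutSloop {e : M.E} (h : M.Admissible (M.tgt e) q T r) :
    (M.cutSloop (M.tgt e) e).Admissible (M.cutSloopInit (M.tgt e) e) (M.cutSloopTerm (M.tgt e) e)
      ({f : (M.loopClosure (M.tgt e) e).toAutomaton.E | f.1 ∈ T} ∪
        {f | (M.loopClosure (M.tgt e) e).toAutomaton.tgt f = M.loopClosureBase (M.tgt e) e})
      (M.cutSloopRank (M.tgt e) e r) := by
  set D := M.loopClosure (M.tgt e) e with hDdef
  have hD : ∀ z ∈ D.verts, M.ReachIn (T ∩ D.edges) (M.tgt e) z := fun z hz =>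
    (h.tree.span z).restrict fun f hf _ h₂ => ⟨hf, h.tree.mem_loopClosure_edges.2
      (Or.inl ⟨h.tree.root f hf,
        (h.tree.reachIn_ne_root h₂).trans (h.tree.mem_loopClosure_verts.1 hz)⟩)⟩
  have htree := (h.tree.sub D (M.self_mem_closure _ _ _) hD).cut
  have heD : e ∈ D.edges := h.tree.mem_loopClosure_edges.2 (Or.inr rfl)
  refine ⟨htree, fun x => ⟨(htree.span x).reach, ?_⟩, ?_⟩
  · rcases x with x | ⟨f, hf⟩
    · have h₁ : D.toAutomaton.ReachIn {f | f.1 ∈ {f | M.tgt f ≠ M.tgt e}} x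
          (D.toAutomaton.src ⟨e, heD⟩) :=
        (D.reachIn_iff _).2 ((h.tree.mem_loopClosure_verts.1 x.2).restrict fun f hf _ h₂ =>
          ⟨hf, h.tree.mem_loopClosure_edges.2 (Or.inl ⟨hf, h₂⟩)⟩)
      rw [← loopClosure_tgt_ne] at h₁
      obtain ⟨p, hp⟩ := h₁
      exact ⟨p ++ [⟨e, heD⟩], cut_isPath_inr.2 ⟨p, rfl, hp⟩⟩
    · obtain ⟨h₁, -⟩ | h₁ := h.tree.mem_loopClosure_edges.1 f.2
      · exact absurd (congrArg Subtype.val hf) h₁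
      · obtain rfl : f = ⟨e, heD⟩ := Subtype.ext h₁
        exact Reach.refl _
  · have hr : D.toAutomaton.RankOn {f | f.1 ∈ Tᶜ ∩ {f | M.tgt f ≠ M.tgt e}} (D.rank r) := by
      refine h.rank.sub D Set.inter_subset_left fun f hf hfD g hg hgf _ => ⟨⟨hg, ?_⟩, ?_⟩
      · exact fun hge => hf.2 (hgf.symm.trans hge)
      · refine h.tree.mem_loopClosure_edges.2 (Or.inl ?_)
        rw [hgf]
        refine (h.tree.mem_loopClosure_edges.1 hfD).resolve_right ?_
        rintro rfl
        exact hf.2 rfl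
    have hset : {f : D.toAutomaton.E | f.1 ∈ Tᶜ ∩ {f | M.tgt f ≠ M.tgt e}} =
        ({f : D.toAutomaton.E | f.1 ∈ T} ∪
          {f | D.toAutomaton.tgt f = M.loopClosureBase (M.tgt e) e})ᶜ := by
      rw [Set.compl_union]
      exact congrArg (fun S : Set D.toAutomaton.E => {f : D.toAutomaton.E | f.1 ∈ T}ᶜ ∩ S)
        (loopClosure_tgt_ne e).symm
    rw [hset] at hr
    exact hr.cut fun f hf hfe => hf (Or.inr hfe)

end Admissible

/-- The cut sloop may retain all edges of `M`; what drops is the number of non-tree edges, since `e`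
has become a tree edge. -/
theorem cutSloop_size_lt [Finite M.E] {e : M.E} (he : e ∉ T) :
    Nat.card (M.cutSloop (M.tgt e) e).E +
      ({f : (M.loopClosure (M.tgt e) e).toAutomaton.E | f.1 ∈ T} ∪
        {f | (M.loopClosure (M.tgt e) e).toAutomaton.tgt f =
          M.loopClosureBase (M.tgt e) e})ᶜ.ncard <
      Nat.card M.E + Tᶜ.ncard := by
  refine add_lt_add_of_le_of_lt (Sub.card_edges_le _) (lt_of_le_of_lt
    (Sub.ncard_le_of_subset (B := Tᶜ \ {e}) _ ?_) (Set.ncard_sdiff_singleton_lt_of_mem he))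
  refine fun f hf => ⟨fun hfT => hf (Or.inl hfT), fun hfe => hf (Or.inr (Subtype.ext ?_))⟩
  exact congrArg M.tgt hfe

end Parts

end Automaton

/-! ### The Kleene expression -/

variable {A : Type v} {M : Automaton.{u, v} A} {I q : M.V} {T : Set M.E} {r : M.E → ℕ}

/-- The recursion produces exactly one expression, which is unionless and describes the language of
the acceptor. -/
def HasKleene (M : Automaton.{u, v} A) (I q : M.V) (r : M.E → ℕ) : Prop :=
  ∃ K : RegularExpression A, (∀ K' : RegularExpression A, IsKleene M I q r K' ↔ K' = K) ∧
    Unionless K ∧ K.matches' = M.language I q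

theorem unionless_prod_char (l : List A) : Unionless (l.map char).prod := by
  induction l with
  | nil => exact Unionless.epsilon
  | cons a l ih => exact (Unionless.char a).comp ih

theorem matches'_prod_char (l : List A) : (l.map char).prod.matches' = {l} := by
  induction l with
  | nil => rfl
  | cons a l ih =>
    rw [List.map_cons, List.prod_cons, matches'_mul, ih, matches'_char]
    exact Set.image2_singleton

theorem Automaton.BackTree.hasKleene_of_forall_mem (h : M.BackTree I T) (hT : ∀ e, e ∈ T) :
    HasKleene M I q r := by
  obtain ⟨p, hp, huniq⟩ := h.existsUnique_isSimplePath q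
  have hnb : ∀ e, ¬ M.Bold I e := fun e he => h.bold_iff.1 he (hT e)
  have hmap : (p.map fun e => char (M.lab e)) = (p.map M.lab).map char := by
    rw [List.map_map]
    rfl
  refine ⟨_, fun K' => ⟨fun hK => ?_, ?_⟩, hmap ▸ unionless_prod_char _, ?_⟩
  · cases hK with
    | base p' _ hp' => rw [huniq p' hp']
    | elementary e bold => exact absurd bold.choose_spec (hnb _)
    | loop e conn bold => exact absurd bold (hnb e)
  · rintro rfl
    exact IsKleene.base p hnb hp
  · rw [hmap, matches'_prod_char]
    ext w
    constructor
    · rintro rfl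
      exact ⟨p, hp.1, rfl⟩
    · rintro ⟨p', hp', rfl⟩
      rw [h.eq_of_isPathIn_root ⟨hp', fun e _ => hT e⟩ ⟨hp.1, fun e _ => hT e⟩]
      rfl

theorem Automaton.BackTree.hasKleene_elementary (h : M.BackTree I T) (bold : ∃ f, f ∉ T) {e : M.E}
    (he : M.IsTransition e) (hI : M.Reach I (M.src e)) (hq : M.SameComp q (M.tgt e))
    (h₁ : HasKleene (M.above (M.src e)).toAutomaton ⟨I, mem_above hI⟩
        ⟨M.src e, M.self_mem_above (M.src e)⟩ ((M.above (M.src e)).rank r))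
    (h₂ : HasKleene (M.strongComp (M.tgt e)).toAutomaton
        ⟨M.tgt e, M.self_mem_strongComp (M.tgt e)⟩ ⟨q, mem_strongComp hq⟩
        ((M.strongComp (M.tgt e)).rank r)) :
    HasKleene M I q r := by
  obtain ⟨K₁, hK₁, hu₁, hl₁⟩ := h₁
  obtain ⟨K₂, hK₂, hu₂, hl₂⟩ := h₂
  have hbold : ∃ f, M.Bold I f := bold.imp fun f hf => h.bold_iff.2 hf
  refine ⟨K₁ * char (M.lab e) * K₂, fun K' => ⟨fun hK => ?_, ?_⟩,
    (hu₁.comp (Unionless.char _)).comp hu₂, ?_⟩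
  · cases hK with
    | base p nb _ => exact absurd hbold.choose_spec (nb _)
    | elementary e' _ he' hI' hq' k₁ k₂ =>
      obtain rfl := h.eq_of_isTransition he he' (hq.symm.trans hq')
      rw [(hK₁ _).1 k₁, (hK₂ _).1 k₂]
    | loop e' conn => exact absurd ⟨conn _ _, conn _ _⟩ he
  · rintro rfl
    exact IsKleene.elementary e hbold he hI hq ((hK₁ _).2 rfl) ((hK₂ _).2 rfl)
  · rw [matches'_mul, matches'_mul, hl₁.trans (above_language hI),
      hl₂.trans (strongComp_language hq), matches'_char, h.elementary_decomposition he hI hq]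

/-- Any other choice of edge in the recursion also has maximal rank at the root, so equal rank and
injectivity identify it with `e`. -/
theorem Automaton.BackTree.hasKleene_loop {e : M.E} (h : M.BackTree (M.tgt e) T)
    (conn : ∀ x y, M.Reach x y) (bold : e ∉ T) (hr : M.RankOn Tᶜ r)
    (hmax : ∀ f, f ∉ T → M.tgt f = M.tgt e → r f ≤ r e)
    (h₁ : HasKleene (M.removeComp e (M.tgt e)).toAutomaton
        ⟨M.tgt e, M.self_mem_removeComp e (M.tgt e)⟩ ⟨M.tgt e, M.self_mem_removeComp e (M.tgt e)⟩
        ((M.removeComp e (M.tgt e)).rank r))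
    (h₂ : HasKleene (M.cutSloop (M.tgt e) e) (M.cutSloopInit (M.tgt e) e)
        (M.cutSloopTerm (M.tgt e) e) (M.cutSloopRank (M.tgt e) e r))
    (h₃ : HasKleene (M.geodesicClosure (M.tgt e) q).toAutomaton
        ⟨M.tgt e, M.self_mem_closure (M.tgt e) (M.tgt e) (M.geodesic (M.tgt e) (M.tgt e) q)⟩
        ⟨q, M.terminal_mem_geodesicClosure (M.tgt e) q⟩
        ((M.geodesicClosure (M.tgt e) q).rank r)) :
    HasKleene M (M.tgt e) q r := by
  obtain ⟨K₁, hK₁, hu₁, hl₁⟩ := h₁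
  obtain ⟨K₂, hK₂, hu₂, hl₂⟩ := h₂
  obtain ⟨K₃, hK₃, hu₃, hl₃⟩ := h₃
  have hbold : M.Bold (M.tgt e) e := h.bold_iff.2 bold
  refine ⟨K₁ * star (K₂ * K₁) * K₃, fun K' => ⟨fun hK => ?_, ?_⟩,
    (hu₁.comp (Unionless.star (hu₂.comp hu₁))).comp hu₃, ?_⟩
  · cases hK with
    | base p nb _ => exact absurd hbold (nb _)
    | elementary e' _ he' => exact absurd ⟨conn _ _, conn _ _⟩ he'
    | loop e' _ bold' he' hmax' k₁ k₂ k₃ =>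
      have hT' := h.bold_iff.1 bold'
      obtain rfl : e = e' :=
        hr.inj e bold e' hT' he'.symm ((hmax' e hbold rfl).antisymm (hmax e' hT' he'))
      rw [(hK₁ _).1 k₁, (hK₂ _).1 k₂, (hK₃ _).1 k₃]
  · rintro rfl
    exact IsKleene.loop e conn hbold rfl (fun f hf => hmax f (h.bold_iff.1 hf)) ((hK₁ _).2 rfl)
      ((hK₂ _).2 rfl) ((hK₃ _).2 rfl)
  · rw [matches'_mul, matches'_mul, matches'_star, matches'_mul,
      hl₁.trans (removeComp_language _ _), hl₂.trans h.cutSloop_language,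
      hl₃.trans (h.geodesicClosure_language q), loop_decomposition]

theorem Automaton.Admissible.hasKleene [Finite M.E] (h : M.Admissible I q T r) : HasKleene M I q r := by
  obtain ⟨n, hn⟩ : ∃ n, Nat.card M.E + Tᶜ.ncard = n := ⟨_, rfl⟩
  induction n using Nat.strong_induction_on generalizing M with
  | _ n ih =>
  subst hn
  by_cases hT : ∀ e, e ∈ T
  · exact h.tree.hasKleene_of_forall_mem hT
  push Not at hT
  by_cases conn : ∀ x y, M.Reach x y
  -- The last edge of a nonempty path back to the root is not in the tree. If that path from `src f`
  -- is empty, `f` starts at the root and must be a loop there.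
  · obtain ⟨e₀, he₀, he₀I⟩ : ∃ e, e ∉ T ∧ M.tgt e = I := by
      obtain ⟨f, hf⟩ := hT
      rcases (reachIn_univ.2 (conn (M.src f) I)).eq_or_last with h₁ | ⟨g, -, hg, -⟩
      · rcases (h.tree.back f hf).eq_or_last with h₂ | ⟨g, hg, hgf, -⟩
        · exact ⟨f, hf, h₂.trans h₁⟩
        · exact absurd (hgf.trans h₁) (h.tree.root g hg)
      · exact ⟨g, fun hgT => h.tree.root g hgT hg, hg⟩
    obtain ⟨e, ⟨he, rfl⟩, hmax⟩ :=
      Set.exists_max_image {e | e ∉ T ∧ M.tgt e = I} r (Set.toFinite _) ⟨e₀, he₀, he₀I⟩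
    have hmax' : ∀ f, f ∉ T → M.tgt f = M.tgt e → r f ≤ r e := fun f h₁ h₂ => hmax f ⟨h₁, h₂⟩
    have : ∀ D : M.Sub, Finite D.toAutomaton.E := fun D => Subtype.finite
    have : Finite (M.cutSloop (M.tgt e) e).E := Subtype.finite
    refine h.tree.hasKleene_loop conn he h.rank hmax'
      (ih _ (Sub.size_lt _ (e := e) ?_ T) (h.removeComp he hmax') rfl)
      (ih _ (cutSloop_size_lt he) h.cutSloop rfl)
      (ih _ (Sub.size_lt _ (e := e) ?_ T) (h.geodesicClosure q) rfl)
    · exact fun k => k.1 rfl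
    · exact fun k => (h.tree.mem_geodesicClosure_edges.1 k).1 rfl
  -- By trimness, a path from `q` back to `I` would make the whole automaton strongly connected.
  · have hIq : ¬ M.SameComp I q := fun k =>
      conn fun x y => (h.trim x).2.trans (k.2.trans (h.trim y).1)
    obtain ⟨p, hp⟩ := (h.trim I).2
    obtain ⟨p₁, e, p₂, -, h₁, -, he, hq⟩ := exists_entering hp hIq
    have : ∀ D : M.Sub, Finite D.toAutomaton.E := fun D => Subtype.finite
    refine h.tree.hasKleene_elementary hT he ⟨p₁, h₁⟩ hq
      (ih _ (Sub.size_lt _ (e := e) ?_ T) (h.above ⟨p₁, h₁⟩) rfl)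
      (ih _ (Sub.size_lt _ (e := e) ?_ T) (h.strongComp he hq) rfl)
    · exact fun k => he ⟨Reach.edge e, k.2.2⟩
    · exact fun k => he k.2.1

end GeomAut

theorem mainTheorem3 {A : Type v} (M : GeomAut.Automaton.{u, v} A) [Finite M.V] [Finite M.E]
    (I q : M.V) (htrim : M.Trim I q) (huspp : M.UniqueSimplePath I)
    (r : M.E → ℕ) (hr : M.IsGeometricRank I r) :
    ∃ K : RegularExpression A,
      (∀ K' : RegularExpression A, GeomAut.IsKleene M I q r K' ↔ K' = K) ∧
      GeomAut.Unionless K ∧ K.matches' = M.language I q := by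
  obtain ⟨T, hT⟩ := huspp.exists_backTree
  have hB : {e | M.Bold I e} = Tᶜ := Set.ext fun e => hT.bold_iff
  exact GeomAut.Automaton.Admissible.hasKleene ⟨hT, htrim, hB ▸ hr.rankOn⟩
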